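/- Let $k\ge 0$ and $t\ge 3$ be integers, let $\varepsilon>0$ be real, and let $P:\{0,1\}^k\to\{0,1\}$ be $(t-1)$-wise uniform supporting: there is a probability distribution $\mu$ on $\{0,1\}^k$, supported on satisfying assignments of $P$, such that $\Pr_{z\sim\mu}[z_T=\alpha]=2^{-|T|}$ for all $T\subseteq[k]$ with $1\le|T|\le t-1$ and all $\alpha\in\{0,1\}^T$. A random instance $\mathcal I$ of $\mathrm{CSP}(P)$ with $n$ variables and $m$ constraints consists of $m$ constraints $(c,S)$ drawn independently and uniformly, with replacement, from $\{0,1\}^k\times[n]^k$; the constraint $(c,S)$ requires $P(x_S\oplus c)=1$. Put $a^{(0)}=a$ and $a^{(1)}=1-a$, applied coordinatewise to vectors. Let $P'$ be the multilinear polynomial that agrees with $P$ on $\{0,1\}^k$. Let $$R_{\mathcal I}=\{P'(x_S^{(c)})-1\ge0,\ 1-P'(x_S^{(c)})\ge 0 : (c,S)\in\mathcal I\},$$ $$L_{\mathcal I}=\Big\{\sum_{i=1}^k x_{S_i}^{(c_i\oplus f_i)}-1\ge 0 : (c,S)\in\mathcal I,\ f\in\{0,1\}^k,\ P(f)=0\Big\}.$$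 For $T\subseteq[n]$ and $\alpha\in\{0,1\}^T$ let $1_{\{x_T=\alpha\}}(x)=\prod_{i\in T,\alpha_i=1}x_i\prod_{i\in T,\alpha_i=0}(1-x_i)$. Degrees of polynomials below are multilinear degrees, i.e. degrees after replacing every power $x_i^e$, $e\ge1$, by $x_i$. * An $\mathrm{SA}_+$ refutation of a set $A$ of polynomial inequalities $g\ge 0$ is an identity $$\sum_i\gamma_i\,g_i\,1_{\{x_{T_i}=\alpha_i\}}+\sum_j(x_j^2-x_j)h_j+\sum_\ell\eta_\ell^2=-1,$$ where $\gamma_i\ge0$, each $g_i\ge 0$ is in $A$ or is the trivial inequality $1\ge0$, the $h_j$ are arbitrary polynomials and the $\eta_\ell$ are affine. * A static $\mathrm{LS}_+$ refutation of $A$ is an identity $$\sum_i\gamma_i\,b_i\,1_{\{x_{T_i}=\alpha_i\}}+\sum_j(x_j^2-x_j)h_j=-1,$$ where $\gamma_i\ge0$, each $b_i$ either has $(b_i\ge 0)\in A$ or is the square of an affine function, and the $h_j$ are arbitrary polynomials. * In both cases the degree of the refutation is the maximum degree of a term. * An $\mathrm{LS}_+$ refutation of $A$ is a finite sequence of inequalities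 containing $-1\ge0$, each of which is a member of $A$ or is obtained by one of the following rules: from $Q\ge0$ with $\deg Q\le1$ infer $x_iQ\ge0$ or $(1-x_i)Q\ge0$ (lifting steps); infer $Q^2\ge0$ whenever $\deg Q\le1$; from $Q\ge0$ and $R\ge0$ infer $aQ+bR\ge0$ for reals $a,b\ge0$; and polynomials with the same multilinear reduction may replace each other. Its rank is the maximum number of lifting steps on a path of the derivation that ends at $-1\ge0$. Then there is a constant $c>0$, depending only on $k,P,t,\varepsilon$, such that for every sequence $m=m(n)\le n^{t/2-\varepsilon}$, with probability tending to $1$ as $n\to\infty$, all of the following hold for a random instance $\mathcal I$ with $n$ variables and $m$ constraints: every $\mathrm{SA}_+$ refutation of $R_{\mathcal I}$ and every static $\mathrm{LS}_+$ refutation of $R_{\mathcal I}$ has degree at least $c\,n^{\varepsilon/(t-2)}$, and every $\mathrm{LS}_+$ refutation of $L_{\mathcal I}$ has rank at least $c\,n^{\varepsilon/(t-2)}$. -/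

import Mathlib

noncomputable section

namespace RandomCSP

open MvPolynomial

/-! ## Boolean CSPs and random instances -/

/-- A Boolean predicate of arity `k`. -/
abbrev Predicate (k : ℕ) := (Fin k → Bool) → Bool

/-- A constraint on `n` variables: a negation pattern `c ∈ {0,1}^k` and a scope `S ∈ [n]^k`
(an ordered tuple, repetitions allowed). It requires `P(x_S + c) = 1`. -/
abbrev Constraint (n k : ℕ) := (Fin k → Bool) × (Fin k → Fin n)

/-- An instance with `n` variables and `m` constraints, listed with multiplicity. -/
abbrev Instance (n k m : ℕ) := Fin m → Constraint n k

/-- The probability of an event when the `m` constraints are drawn independently and uniformly,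
with replacement, from all `2^k n^k` constraints, that is, under the uniform distribution on
`Instance n k m`. -/
def prob {n k m : ℕ} (E : Set (Instance n k m)) : ℝ :=
  (E.ncard : ℝ) / (Fintype.card (Instance n k m) : ℝ)

/-- `P` is `s`-wise uniform supporting: some probability distribution `μ` on `{0,1}^k`, supported
on satisfying assignments of `P`, has uniform marginals on all sets of between `1` and `s`
coordinates. (Only the values of `a` on `T` matter below.) -/
def UniformSupporting {k : ℕ} (s : ℕ) (P : Predicate k) : Prop :=
  ∃ μ : (Fin k → Bool) → ℝ,
    (∀ z, 0 ≤ μ z) ∧ (∑ z, μ z = 1) ∧ (∀ z, μ z ≠ 0 → P z = true) ∧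
    ∀ T : Finset (Fin k), 1 ≤ T.card → T.card ≤ s → ∀ a : Fin k → Bool,
      ∑ z with (∀ i ∈ T, z i = a i), μ z = ((1 : ℝ) / 2) ^ T.card

/-! ## Polynomials -/

/-- Real polynomials in `x_1, …, x_n`. -/
abbrev RPoly (n : ℕ) := MvPolynomial (Fin n) ℝ

/-- Replace every power `x_i ^ e` with `e ≥ 1` by `x_i`. -/
def multilinearize {n : ℕ} (p : RPoly n) : RPoly n :=
  ∑ s ∈ p.support, monomial (s.mapRange (fun e => min e 1) rfl) (p.coeff s)

/-- The multilinear degree: the degree after multilinear reduction. -/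
def mlDegree {n : ℕ} (p : RPoly n) : ℕ := (multilinearize p).totalDegree

/-- `a^{(b)}`: it is `a` if `b = 0` and `1 - a` if `b = 1`. -/
def signed {n : ℕ} (b : Bool) (a : RPoly n) : RPoly n := if b then 1 - a else a

/-- The indicator polynomial of the event `x_T = α` (only the values of `α` on `T` matter). -/
def indicatorPoly {n : ℕ} (T : Finset (Fin n)) (α : Fin n → Bool) : RPoly n :=
  ∏ i ∈ T, signed (!α i) (X i)

/-- The multilinear polynomial `P'` in `k` variables that agrees with `P` on `{0,1}^k`. -/
def predPoly {k : ℕ} (P : Predicate k) : RPoly k :=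
  ∑ z with P z = true, indicatorPoly Finset.univ z

/-- The polynomial `P'(x_S^{(c)})` of a constraint `(c, S)`. -/
def constraintPoly {n k : ℕ} (P : Predicate k) (C : Constraint n k) : RPoly n :=
  aeval (fun i => signed (C.1 i) (X (C.2 i) : RPoly n)) (predPoly P)

/-- The degree-`k` formulation: each equality `P'(x_S^{(c)}) = 1` is written as the two
inequalities `P'(x_S^{(c)}) - 1 ≥ 0` and `1 - P'(x_S^{(c)}) ≥ 0`. A set `A` of polynomials stands
for the inequalities `g ≥ 0`, `g ∈ A`. -/
def degKFormulation {n k m : ℕ} (P : Predicate k) (I : Instance n k m) : Set (RPoly n) :=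
  {g | ∃ j, g = constraintPoly P (I j) - 1 ∨ g = 1 - constraintPoly P (I j)}

/-- The linear formulation: `∑ i, x_{S_i}^{(c_i ⊕ f_i)} - 1 ≥ 0` for every constraint `(c, S)` and
every `f ∈ {0,1}^k` with `P(f) = 0`. -/
def linFormulation {n k m : ℕ} (P : Predicate k) (I : Instance n k m) : Set (RPoly n) :=
  {g | ∃ j, ∃ f : Fin k → Bool, P f = false ∧
    g = ∑ i, signed (xor ((I j).1 i) (f i)) (X ((I j).2 i)) - 1}

/-! ## Static proof systems -/

/-- An `SA₊` refutation of `A`: an identity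
`∑ γ_i g_i 1{x_{T_i} = α_i} + ∑ (x_j² - x_j) h_j + ∑ η_l² = -1`
with `γ_i ≥ 0`, every `g_i` in `A` or equal to the trivial inequality `1 ≥ 0`, arbitrary
polynomials `h_j`, and affine `η_l`. -/
structure SAPlusRefutation {n : ℕ} (A : Set (RPoly n)) where
  N : ℕ
  γ : Fin N → ℝ
  g : Fin N → RPoly n
  T : Fin N → Finset (Fin n)
  α : Fin N → Fin n → Bool
  h : Fin n → RPoly n
  L : ℕ
  η : Fin L → RPoly n
  γ_nonneg : ∀ i, 0 ≤ γ i
  g_mem : ∀ i, g i ∈ A ∨ g i = 1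
  η_affine : ∀ l, (η l).totalDegree ≤ 1
  identity : ∑ i, C (γ i) * g i * indicatorPoly (T i) (α i)
    + ∑ j, (X j ^ 2 - X j) * h j + ∑ l, η l ^ 2 = -1

/-- The degree of an `SA₊` refutation: the maximum (multilinear) degree of its terms. -/
def SAPlusRefutation.degree {n : ℕ} {A : Set (RPoly n)} (π : SAPlusRefutation A) : ℕ :=
  max (max (Finset.univ.sup fun i => mlDegree (C (π.γ i) * π.g i * indicatorPoly (π.T i) (π.α i)))
      (Finset.univ.sup fun j => mlDegree ((X j ^ 2 - X j) * π.h j)))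
    (Finset.univ.sup fun l => mlDegree (π.η l ^ 2))

/-- A static `LS₊` refutation of `A`: an identity
`∑ γ_i b_i 1{x_{T_i} = α_i} + ∑ (x_j² - x_j) h_j = -1`
with `γ_i ≥ 0`, every `b_i` in `A` or the square of an affine function, and arbitrary
polynomials `h_j`. -/
structure StaticLSPlusRefutation {n : ℕ} (A : Set (RPoly n)) where
  N : ℕ
  γ : Fin N → ℝ
  b : Fin N → RPoly n
  T : Fin N → Finset (Fin n)
  α : Fin N → Fin n → Bool
  h : Fin n → RPoly n
  γ_nonneg : ∀ i, 0 ≤ γ i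
  b_mem : ∀ i, b i ∈ A ∨ ∃ η : RPoly n, η.totalDegree ≤ 1 ∧ b i = η ^ 2
  identity : ∑ i, C (γ i) * b i * indicatorPoly (T i) (α i)
    + ∑ j, (X j ^ 2 - X j) * h j = -1

/-- The degree of a static `LS₊` refutation: the maximum (multilinear) degree of its terms. -/
def StaticLSPlusRefutation.degree {n : ℕ} {A : Set (RPoly n)}
    (π : StaticLSPlusRefutation A) : ℕ :=
  max (Finset.univ.sup fun i => mlDegree (C (π.γ i) * π.b i * indicatorPoly (π.T i) (π.α i)))
    (Finset.univ.sup fun j => mlDegree ((X j ^ 2 - X j) * π.h j))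

/-! ## The dynamic proof system `LS₊` -/

/-- One inference of an `LS₊` proof from `A`. A line `(Q, ρ)` is the inequality `Q ≥ 0` with the
maximum number `ρ` of lifting steps (multiplications by `x_i` or `1 - x_i`) on a path of the proof
that ends at the line; `prev` holds the earlier lines. Lifting and squaring are allowed only for
polynomials of (multilinear) degree at most `1`, and polynomials that coincide after
`x_i² = x_i` may replace each other. -/
inductive LSPlusStep {n : ℕ} (A : Set (RPoly n)) (prev : List (RPoly n × ℕ)) :
    RPoly n × ℕ → Prop
  | hyp (Q : RPoly n) : Q ∈ A → LSPlusStep A prev (Q, 0)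
  | square (Q : RPoly n) : mlDegree Q ≤ 1 → LSPlusStep A prev (Q ^ 2, 0)
  | mulVar (Q : RPoly n) (ρ : ℕ) (i : Fin n) : (Q, ρ) ∈ prev → mlDegree Q ≤ 1 →
      LSPlusStep A prev (X i * Q, ρ + 1)
  | mulCompl (Q : RPoly n) (ρ : ℕ) (i : Fin n) : (Q, ρ) ∈ prev → mlDegree Q ≤ 1 →
      LSPlusStep A prev ((1 - X i) * Q, ρ + 1)
  | combine (Q R : RPoly n) (ρ σ : ℕ) (a b : ℝ) : (Q, ρ) ∈ prev → (R, σ) ∈ prev →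
      0 ≤ a → 0 ≤ b → LSPlusStep A prev (C a * Q + C b * R, max ρ σ)
  | reduce (Q R : RPoly n) (ρ : ℕ) : (Q, ρ) ∈ prev → multilinearize R = multilinearize Q →
      LSPlusStep A prev (R, ρ)

/-- An `LS₊` proof from `A`: a finite sequence of lines (most recent first), each inferred from
earlier ones. -/
inductive IsLSPlusProof {n : ℕ} (A : Set (RPoly n)) : List (RPoly n × ℕ) → Prop
  | nil : IsLSPlusProof A []
  | cons (q : RPoly n × ℕ) (l : List (RPoly n × ℕ)) : IsLSPlusProof A l → LSPlusStep A l q →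
      IsLSPlusProof A (q :: l)

/-- An `LS₊` refutation of `A`: an `LS₊` proof that contains the root line `-1 ≥ 0`. Its rank is
the maximum number of lifting steps on a path to the root. -/
structure LSPlusRefutation {n : ℕ} (A : Set (RPoly n)) where
  lines : List (RPoly n × ℕ)
  isProof : IsLSPlusProof A lines
  rank : ℕ
  root : ((-1 : RPoly n), rank) ∈ lines

end RandomCSP

end

noncomputable section

namespace RandomCSP

/-! ## Characters of the cube -/

/-! One linear functional on functions on the cube defeats all three proof systems. Let `μ` be the
given distribution. The product over all constraints of the densities `2^k μ(x_S ⊕ c)` need not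
define a distribution, but it can be multiplied out in Fourier characters and cut to the terms that
involve at most `r` constraints. Summing against this truncation gives `pseudoExp`. Uniformity of
`μ` kills every term that uses between 1 and `t - 1` coordinates of some constraint, so the
surviving choices of coordinates are `Admissible`.

A term contributes to the pseudo-expectation of a function of the variables in `b` only if it covers
every variable outside `b` an even number of times. Such a term has few distinct variables: a
constraint has at least `t` chosen coordinates, and each variable outside `b` that they meet is met
at least twice, so the constraint adds at most `k - t/2` variables on average. If every small set of
constraints has at least `k - t/2 + δ` variables per constraint, this can happen only inside a small
closure `H` of the given variables (`exists_closure`). Locally the functional is therefore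
integration against an honest nonnegative product of densities (`pseudoExp_eq_of_closed`), supported
on assignments that satisfy the constraints involved. This gives nonnegativity of small indicators,
also when multiplied by a constraint inequality.

Squares of affine functions involve all variables and are not local. For an indicator `g`, the
matrix `E[g] E[g x_i x_j] - E[g x_i] E[g x_j]`, with `x_i` the signs, is handled by separators: each
variable lies in a small set `b` such that the sign of every outside variable is pseudo-independent
of functions on `b` (`exists_separator`). The entries between `b` and its complement vanish, the
blocks are positive semidefinite by local positivity, and hence so is the whole matrix
(`pseudoExp_mul_sq_nonneg`).

Applied to a static refutation of degree at most `d`, the functional gives a nonnegative value to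
the left side and `-1` to the right. For the dynamic system, each lifting step uses up one variable
of conditioning (`IsPseudoExp.lsPlus_line_nonneg`). A first-moment bound shows that random instances
expand to scale `n ^ (ε / (t - 2))` with high probability (`tendsto_prob_not_expanding_ceil`). -/

/-- The sign `(-1)^b`. -/
def boolSign (b : Bool) : ℝ := if b then -1 else 1

lemma boolSign_not (b : Bool) : boolSign (!b) = -boolSign b := by cases b <;> simp [boolSign]

lemma boolSign_xor (a b : Bool) : boolSign (xor a b) = boolSign a * boolSign b := by
  cases a <;> cases b <;> simp [boolSign]

lemma boolSign_mul_self (b : Bool) : boolSign b * boolSign b = 1 := by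
  cases b <;> simp [boolSign]

lemma abs_boolSign (b : Bool) : |boolSign b| = 1 := by cases b <;> simp [boolSign]

/-- The character of the cube with exponent vector `e`. -/
def signPow {n : ℕ} (e : Fin n → ℕ) (x : Fin n → Bool) : ℝ := ∏ v, boolSign (x v) ^ e v

lemma signPow_of_even {n : ℕ} {e : Fin n → ℕ} (he : ∀ v, Even (e v)) (x : Fin n → Bool) :
    signPow e x = 1 := by
  refine Finset.prod_eq_one fun v _ => ?_
  obtain ⟨r, hr⟩ := he v
  rw [hr, pow_add, ← mul_pow, boolSign_mul_self, one_pow]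

lemma signPow_add {n : ℕ} (e e' : Fin n → ℕ) (x : Fin n → Bool) :
    signPow (e + e') x = signPow e x * signPow e' x := by
  simp [signPow, pow_add, Finset.prod_mul_distrib]

lemma signPow_single {n : ℕ} (v : Fin n) (x : Fin n → Bool) :
    signPow (Pi.single v 1) x = boolSign (x v) := by
  unfold signPow
  rw [Finset.prod_eq_single v]
  · simp
  · intro w _ hw
    simp [hw]
  · simp

lemma signPow_update_not {n : ℕ} (e : Fin n → ℕ) (v : Fin n) (he : Odd (e v))
    (x : Fin n → Bool) : signPow e (Function.update x v (!x v)) = -signPow e x := by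
  unfold signPow
  rw [← Finset.mul_prod_erase _ _ (Finset.mem_univ v),
    ← Finset.mul_prod_erase Finset.univ (fun w => boolSign (x w) ^ e w) (Finset.mem_univ v)]
  simp only [Function.update_self, boolSign_not, he.neg_pow, neg_mul]
  congr 2
  refine Finset.prod_congr rfl fun w hw => ?_
  rw [Function.update_of_ne (Finset.ne_of_mem_erase hw)]

/-- Flipping coordinate `v` fixes `f` and negates the character, so the sum equals its own negative.
All cancellation of Fourier terms comes from here. -/
lemma sum_mul_signPow_eq_zero {n : ℕ} {f : (Fin n → Bool) → ℝ} {b : Finset (Fin n)}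
    (hf : DependsOn f (b : Set (Fin n))) {e : Fin n → ℕ} {v : Fin n} (hv : v ∉ b)
    (he : Odd (e v)) : ∑ x, f x * signPow e x = 0 := by
  have hinv : Function.Involutive (fun x : Fin n → Bool => Function.update x v (!x v)) := by
    intro x; simp
  have h := Equiv.sum_comp (hinv.toPerm _) (fun x => f x * signPow e x)
  have h2 : ∀ x, f (hinv.toPerm _ x) * signPow e (hinv.toPerm _ x) = -(f x * signPow e x) := by
    intro x
    have h3 : f (hinv.toPerm _ x) = f x := by
      apply hf
      intro i hi
      have : i ≠ v := fun h => hv (h ▸ hi)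
      simp [Function.Involutive.toPerm, this]
    have h4 : signPow e (hinv.toPerm _ x) = -signPow e x := signPow_update_not e v he x
    rw [h3, h4, mul_neg]
  simp only [h2, Finset.sum_neg_distrib] at h
  linarith

/-! ## The Fourier expansion of the density of a constraint -/

variable {n k m : ℕ}

/-- The character `V` of the shifted scope `x_S + c`. -/
def scopeSign (C : Constraint n k) (V : Finset (Fin k)) (x : Fin n → Bool) : ℝ :=
  ∏ i ∈ V, boolSign (xor (x (C.2 i)) (C.1 i))

/-- The Fourier coefficients of a function on `{0,1}^k`. -/
def fourierCoef (μ : (Fin k → Bool) → ℝ) (V : Finset (Fin k)) : ℝ :=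
  ∑ z, μ z * ∏ i ∈ V, boolSign (z i)

/-- The density of `μ` on the shifted scope of a constraint. -/
def density (μ : (Fin k → Bool) → ℝ) (C : Constraint n k) (x : Fin n → Bool) : ℝ :=
  2 ^ k * μ fun i => xor (x (C.2 i)) (C.1 i)

lemma prod_one_add_boolSign (z y : Fin k → Bool) :
    ∏ i, (1 + boolSign (z i) * boolSign (y i)) = if z = y then (2 : ℝ) ^ k else 0 := by
  split_ifs with h
  · subst h
    simp only [boolSign_mul_self]
    norm_num
  · obtain ⟨i, hi⟩ := Function.ne_iff.mp h
    refine Finset.prod_eq_zero (Finset.mem_univ i) ?_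
    rw [← boolSign_xor]
    cases h1 : z i <;> cases h2 : y i <;> simp_all [boolSign]

/-- Fourier inversion: `∏ (1 + z_i y_i)`, in signs, is `2^k` times the indicator of `z = y`, and
multiplying it out gives the characters. -/
lemma density_eq_sum (μ : (Fin k → Bool) → ℝ) (C : Constraint n k) (x : Fin n → Bool) :
    density μ C x = ∑ V : Finset (Fin k), fourierCoef μ V * scopeSign C V x := by
  simp only [fourierCoef, scopeSign, Finset.sum_mul]
  rw [Finset.sum_comm]
  have h : ∀ z, ∑ V : Finset (Fin k), μ z * (∏ i ∈ V, boolSign (z i)) *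
      ∏ i ∈ V, boolSign (xor (x (C.2 i)) (C.1 i)) =
      μ z * if z = (fun i => xor (x (C.2 i)) (C.1 i)) then (2 : ℝ) ^ k else 0 := by
    intro z
    rw [← prod_one_add_boolSign, Finset.prod_one_add, Finset.mul_sum, Finset.powerset_univ]
    refine Finset.sum_congr rfl fun V _ => ?_
    rw [Finset.prod_mul_distrib, mul_assoc]
  simp only [h]
  simp [density, mul_comm]

lemma fourierCoef_empty {μ : (Fin k → Bool) → ℝ} (h : ∑ z, μ z = 1) : fourierCoef μ ∅ = 1 := by
  simpa [fourierCoef] using h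

lemma sum_prod_boolSign_eq_zero {V : Finset (Fin k)} (hV : V.Nonempty) :
    ∑ a : Fin k → Bool, ∏ i ∈ V, boolSign (a i) = 0 := by
  obtain ⟨v, hv⟩ := hV
  have h := sum_mul_signPow_eq_zero (f := fun _ : Fin k → Bool => (1 : ℝ)) (b := ∅)
    (e := fun i => if i ∈ V then 1 else 0) (v := v) (fun _ _ _ => rfl) (by simp) (by simp [hv])
  rw [← h]
  refine Finset.sum_congr rfl fun a _ => ?_
  rw [one_mul, signPow, ← Finset.prod_subset (Finset.subset_univ V)]
  · exact Finset.prod_congr rfl fun i hi => by rw [if_pos hi, pow_one]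
  · intro i _ hi
    rw [if_neg hi, pow_zero]

/-- Average the character on `V` against the marginals of `μ` on `V`. The marginals are constant, so
the average is zero; on the other hand each `z` agrees on `V` with `2^(k - |V|)` vectors `a`, so it
is a nonzero multiple of the coefficient. -/
lemma fourierCoef_eq_zero {μ : (Fin k → Bool) → ℝ} {s : ℕ}
    (hμ : ∀ T : Finset (Fin k), 1 ≤ T.card → T.card ≤ s → ∀ a : Fin k → Bool,
      ∑ z with (∀ i ∈ T, z i = a i), μ z = ((1 : ℝ) / 2) ^ T.card)
    {V : Finset (Fin k)} (hV : V.Nonempty) (hVs : V.card ≤ s) : fourierCoef μ V = 0 := by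
  have h1 : ∑ a : Fin k → Bool, (∏ i ∈ V, boolSign (a i)) *
      ∑ z with (∀ i ∈ V, z i = a i), μ z = 0 := by
    simp only [hμ V hV.card_pos hVs, ← Finset.sum_mul, sum_prod_boolSign_eq_zero hV, zero_mul]
  have hcard : ∀ z : Fin k → Bool,
      ((Finset.univ.filter fun a : Fin k → Bool => ∀ i ∈ V, z i = a i).card : ℝ) =
        ∏ i : Fin k, if i ∈ V then 1 else 2 := by
    intro z
    have : (Finset.univ.filter fun a : Fin k → Bool => ∀ i ∈ V, z i = a i) =
        Fintype.piFinset fun i => if i ∈ V then {z i} else Finset.univ := by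
      ext a
      simp only [Finset.mem_filter, Finset.mem_univ, true_and, Fintype.mem_piFinset]
      refine forall_congr' fun i => ?_
      by_cases hi : i ∈ V
      · simp only [hi, forall_true_left, if_true, Finset.mem_singleton]
        exact eq_comm
      · simp [hi]
    rw [this, Fintype.card_piFinset, Nat.cast_prod]
    refine Finset.prod_congr rfl fun i _ => ?_
    by_cases hi : i ∈ V <;> simp [hi]
  have h2 : ∑ a : Fin k → Bool, (∏ i ∈ V, boolSign (a i)) *
      ∑ z with (∀ i ∈ V, z i = a i), μ z =
      (∏ i : Fin k, if i ∈ V then 1 else 2) * fourierCoef μ V := by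
    simp only [Finset.sum_filter, Finset.mul_sum, fourierCoef]
    rw [Finset.sum_comm]
    refine Finset.sum_congr rfl fun z _ => ?_
    rw [← hcard z, Finset.card_filter, Nat.cast_sum, Finset.sum_mul]
    refine Finset.sum_congr rfl fun a _ => ?_
    split_ifs with h
    · rw [Finset.prod_congr rfl fun i hi => by rw [← h i hi]]
      push_cast; ring
    · simp
  rw [h2] at h1
  refine (mul_eq_zero.mp h1).resolve_left (Finset.prod_ne_zero_iff.mpr fun i _ => ?_)
  split_ifs <;> norm_num

/-! ## Products of characters over an instance -/

/-- The number of coordinates chosen by `U` that hold the variable `v`. -/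
def coverCount (I : Instance n k m) (U : Fin m → Finset (Fin k)) (v : Fin n) : ℕ :=
  ∑ j, ((U j).filter fun i => (I j).2 i = v).card

/-- The constraints in which `U` chooses a coordinate. -/
def constraintSupport (U : Fin m → Finset (Fin k)) : Finset (Fin m) :=
  Finset.univ.filter fun j => U j ≠ ∅

lemma mem_constraintSupport {U : Fin m → Finset (Fin k)} {j : Fin m} :
    j ∈ constraintSupport U ↔ U j ≠ ∅ := by simp [constraintSupport]

/-- The Fourier term of a product of densities given by a choice `U` of coordinates. -/
def fourierTerm (μ : (Fin k → Bool) → ℝ) (I : Instance n k m) (U : Fin m → Finset (Fin k))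
    (x : Fin n → Bool) : ℝ := ∏ j, fourierCoef μ (U j) * scopeSign (I j) (U j) x

/-- The part of a Fourier term that does not depend on the point. -/
def fourierConst (μ : (Fin k → Bool) → ℝ) (I : Instance n k m) (U : Fin m → Finset (Fin k)) : ℝ :=
  ∏ j, fourierCoef μ (U j) * ∏ i ∈ U j, boolSign ((I j).1 i)

/-- Grouping the chosen coordinates by the variable they hold turns the term into one character.
Multiplicities are kept because variables may repeat within a scope as well as across scopes. -/
lemma fourierTerm_eq (μ : (Fin k → Bool) → ℝ) (I : Instance n k m) (U : Fin m → Finset (Fin k))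
    (x : Fin n → Bool) :
    fourierTerm μ I U x = fourierConst μ I U * signPow (coverCount I U) x := by
  have h : signPow (coverCount I U) x = ∏ j, ∏ i ∈ U j, boolSign (x ((I j).2 i)) := by
    simp only [signPow, coverCount, ← Finset.prod_pow_eq_pow_sum]
    rw [Finset.prod_comm]
    refine Finset.prod_congr rfl fun j _ => ?_
    rw [← Finset.prod_fiberwise (U j) (fun i => (I j).2 i)]
    refine Finset.prod_congr rfl fun v _ => ?_
    rw [Finset.prod_congr rfl (g := fun _ => boolSign (x v)), Finset.prod_const]
    intro i hi
    rw [(Finset.mem_filter.mp hi).2]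
  rw [h, fourierTerm, fourierConst, ← Finset.prod_mul_distrib]
  refine Finset.prod_congr rfl fun j _ => ?_
  simp only [scopeSign, boolSign_xor, Finset.prod_mul_distrib]
  ring

/-- Since the empty coefficient is 1, a constraint outside `H` can be included as a factor whose
only choice is `∅`. -/
lemma prod_density_eq {μ : (Fin k → Bool) → ℝ} (hμ : ∑ z, μ z = 1) (I : Instance n k m)
    (H : Finset (Fin m)) (x : Fin n → Bool) :
    ∏ j ∈ H, density μ (I j) x =
      ∑ U with constraintSupport U ⊆ H, fourierTerm μ I U x := by
  have h1 : ∏ j ∈ H, density μ (I j) x = ∏ j, ∑ V ∈ if j ∈ H then Finset.univ else {∅},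
      fourierCoef μ V * scopeSign (I j) V x := by
    rw [← Finset.prod_subset (Finset.subset_univ H)]
    · refine Finset.prod_congr rfl fun j hj => ?_
      rw [if_pos hj, density_eq_sum]
    · intro j _ hj
      simp [hj, fourierCoef_empty hμ, scopeSign]
  rw [h1, Finset.prod_univ_sum]
  refine Finset.sum_congr ?_ fun U _ => rfl
  ext U
  simp only [Fintype.mem_piFinset, Finset.mem_filter, Finset.mem_univ, true_and,
    Finset.subset_iff, mem_constraintSupport]
  refine forall_congr' fun j => ?_
  by_cases hj : j ∈ H <;> simp [hj]

/-! ## Expansion and closures -/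

/-- The variables that occur in a set of constraints. -/
def scopeVars (I : Instance n k m) (H : Finset (Fin m)) : Finset (Fin n) :=
  H.biUnion fun j => Finset.univ.image (I j).2

lemma mem_scopeVars {I : Instance n k m} {H : Finset (Fin m)} {v : Fin n} :
    v ∈ scopeVars I H ↔ ∃ j ∈ H, ∃ i, (I j).2 i = v := by
  simp [scopeVars]

lemma scopeVars_union (I : Instance n k m) (H H' : Finset (Fin m)) :
    scopeVars I (H ∪ H') = scopeVars I H ∪ scopeVars I H' :=
  Finset.union_biUnion

lemma card_scopeVars_le (I : Instance n k m) (H : Finset (Fin m)) :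
    (scopeVars I H).card ≤ k * H.card := by
  rw [mul_comm]
  refine Finset.card_biUnion_le_card_mul _ _ _ fun j _ => ?_
  exact Finset.card_image_le.trans (by simp)

/-- Every set of at most `s` constraints contains at least `κ` variables per constraint. -/
def Expanding (I : Instance n k m) (κ : ℝ) (s : ℕ) : Prop :=
  ∀ H : Finset (Fin m), H.card ≤ s → κ * H.card ≤ (scopeVars I H).card

/-- Every chosen set of coordinates is empty or has at least `t` elements. -/
def Admissible (t : ℕ) (U : Fin m → Finset (Fin k)) : Prop := ∀ j, U j ≠ ∅ → t ≤ (U j).card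

/-- If all but `J` of the variables outside `b` are not covered exactly once, then the constraints
in `N` add few variables to `b`. -/
lemma card_new_vars_le (I : Instance n k m) {t : ℕ} {U : Fin m → Finset (Fin k)}
    {N : Finset (Fin m)} {b J : Finset (Fin n)} (hU : ∀ j ∈ N, t ≤ (U j).card)
    (hN : ∀ j, j ∉ N → ∀ i ∈ U j, (I j).2 i ∈ b)
    (hJ : ∀ v, v ∉ b → v ∉ J → coverCount I U v ≠ 1) :
    2 * (scopeVars I N \ b).card + ∑ j ∈ N, ((U j).filter fun i => (I j).2 i ∈ b).card + t * N.card
      ≤ 2 * k * N.card + J.card := by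
  classical
  set φ : (Σ _ : Fin m, Fin k) → Fin n := fun p => (I p.1).2 p.2 with hφ
  -- `A` collects the chosen coordinates that leave `b`, and `B` the unchosen ones. Every new
  -- variable is held by one of these; unchosen coordinates count fully, chosen ones by about one
  -- half.
  set A : Finset (Σ _ : Fin m, Fin k) := N.sigma fun j => (U j).filter fun i => (I j).2 i ∉ b
    with hA
  set B : Finset (Σ _ : Fin m, Fin k) := N.sigma fun j => (U j)ᶜ with hB
  have hAcard : ∑ j ∈ N, ((U j).filter fun i => (I j).2 i ∈ b).card + A.card
      = ∑ j ∈ N, (U j).card := by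
    rw [hA, Finset.card_sigma, ← Finset.sum_add_distrib]
    exact Finset.sum_congr rfl fun j _ => Finset.card_filter_add_card_filter_not _
  have hBcard : B.card + ∑ j ∈ N, (U j).card = k * N.card := by
    rw [hB, Finset.card_sigma, ← Finset.sum_add_distrib, Finset.sum_congr rfl (g := fun _ => k)]
    · simp [mul_comm]
    · intro j _
      rw [add_comm, Finset.card_add_card_compl, Fintype.card_fin]
  have ht : t * N.card ≤ ∑ j ∈ N, (U j).card := by
    rw [mul_comm, ← smul_eq_mul]
    exact Finset.card_nsmul_le_sum _ _ _ hU
  have hX : (scopeVars I N \ b).card ≤ (A.image φ).card + B.card := by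
    refine le_trans (Finset.card_le_card ?_)
      ((Finset.card_union_le (A.image φ) (B.image φ)).trans
        (Nat.add_le_add_left Finset.card_image_le _))
    intro v hv
    obtain ⟨hv1, hv2⟩ := Finset.mem_sdiff.mp hv
    obtain ⟨j, hj, i, rfl⟩ := mem_scopeVars.mp hv1
    by_cases hi : i ∈ U j
    · exact Finset.mem_union_left _ (Finset.mem_image.mpr ⟨⟨j, i⟩, by simp [hA, hj, hi, hv2], rfl⟩)
    · exact Finset.mem_union_right _ (Finset.mem_image.mpr ⟨⟨j, i⟩, by simp [hB, hj, hi], rfl⟩)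
  have hfib : ∀ v ∉ b, (A.filter fun p => φ p = v).card = coverCount I U v := by
    intro v hv
    have h1 : (A.filter fun p => φ p = v) =
        N.sigma fun j => (U j).filter fun i => (I j).2 i = v := by
      ext ⟨j, i⟩
      simp only [hA, hφ, Finset.mem_filter, Finset.mem_sigma]
      constructor
      · rintro ⟨⟨h1, h2, _⟩, h3⟩
        exact ⟨h1, h2, h3⟩
      · rintro ⟨h1, h2, h3⟩
        exact ⟨⟨h1, h2, h3 ▸ hv⟩, h3⟩
    rw [h1, Finset.card_sigma, coverCount]
    refine Finset.sum_subset (Finset.subset_univ _) fun j _ hj => ?_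
    rw [Finset.card_eq_zero, Finset.filter_eq_empty_iff]
    exact fun i hi h => hv (h ▸ hN j hj i hi)
  -- A variable met by `A` is met at least twice, unless it is in `J`, where a credit of one makes
  -- up the difference.
  have hmain : 2 * (A.image φ).card ≤ A.card + J.card := by
    rw [Finset.card_eq_sum_card_image φ A]
    have h2 : ∀ v ∈ A.image φ, 2 ≤ (A.filter fun p => φ p = v).card + if v ∈ J then 1 else 0 := by
      intro v hv
      obtain ⟨p, hp, rfl⟩ := Finset.mem_image.mp hv
      have hpb : φ p ∉ b := by
        have := (Finset.mem_sigma.mp hp).2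
        exact (Finset.mem_filter.mp this).2
      have hpos : 0 < (A.filter fun q => φ q = φ p).card :=
        Finset.card_pos.mpr ⟨p, Finset.mem_filter.mpr ⟨hp, rfl⟩⟩
      split_ifs with h
      · omega
      · have := hJ _ hpb h
        rw [← hfib _ hpb] at this
        omega
    have h3 := Finset.card_nsmul_le_sum _ _ _ h2
    rw [Finset.sum_add_distrib, ← Finset.card_filter, smul_eq_mul, mul_comm] at h3
    refine h3.trans (Nat.add_le_add_left (Finset.card_le_card ?_) _)
    exact fun v hv => (Finset.mem_filter.mp hv).2
  have h2k : 2 * k * N.card = 2 * (k * N.card) := by ring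
  omega

/-- In an expanding instance every small set `B` of variables has a closure: a small set `H` of
constraints that contains all admissible choices of coordinates covering every variable outside `H`
and `B` evenly, and is separated from those that cover one further variable oddly. -/
lemma exists_closure {I : Instance n k m} {t s r : ℕ} {δ : ℝ} (hδ : 0 < δ)
    (hI : Expanding I (k - t / 2 + δ) s) (hrs : 2 * r ≤ s) {B : Finset (Fin n)}
    (hB : (B.card : ℝ) ≤ δ * r) :
    ∃ H : Finset (Fin m), δ * H.card ≤ B.card ∧
      (∀ U, Admissible t U → (constraintSupport U).card ≤ r →
        (∀ v ∉ scopeVars I H ∪ B, Even (coverCount I U v)) → constraintSupport U ⊆ H) ∧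
      (∀ U, Admissible t U → (constraintSupport U).card ≤ r → ∀ w,
        (∀ v ∉ scopeVars I H ∪ B, v ≠ w → Even (coverCount I U v)) →
        ∀ j ∉ H, ∀ i ∈ U j, (I j).2 i ∉ scopeVars I H ∪ B) := by
  classical
  -- The closure is a largest set in which each constraint adds at most `k - t/2` variables to `B`
  -- on average. Against expansion by `k - t/2 + δ`, this forces `δ |H| ≤ |B|`.
  set F : Finset (Finset (Fin m)) := Finset.univ.filter fun H => H.card ≤ s ∧
    2 * (scopeVars I H ∪ B).card + t * H.card ≤ 2 * B.card + 2 * k * H.card with hF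
  have hne : F.Nonempty := ⟨∅, Finset.mem_filter.mpr ⟨Finset.mem_univ _, by simp [scopeVars]⟩⟩
  obtain ⟨H, hHF, hmax⟩ := Finset.exists_max_image F Finset.card hne
  obtain ⟨hHs, hH⟩ := (Finset.mem_filter.mp hHF).2
  have hsmall : δ * H.card ≤ B.card := by
    have h1 := hI H hHs
    have h2 : ((scopeVars I H).card : ℝ) ≤ (scopeVars I H ∪ B).card := by
      exact_mod_cast Finset.card_le_card Finset.subset_union_left
    have h3 : (2 * (scopeVars I H ∪ B).card + t * H.card : ℝ) ≤ 2 * B.card + 2 * k * H.card := by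
      exact_mod_cast hH
    nlinarith
  have hHr : H.card ≤ r := by
    have : (H.card : ℝ) ≤ r := le_of_mul_le_mul_left (hsmall.trans hB) hδ
    exact_mod_cast this
  -- If the credits `J` are paid for by chosen coordinates falling back into the closure, adding
  -- `constraintSupport U` to `H` keeps the inequality defining `F`. The union has at most `2 * r ≤
  -- s` constraints, so maximality of `H` applies.
  have key : ∀ U, Admissible t U → (constraintSupport U).card ≤ r → ∀ J : Finset (Fin n),
      (∀ v, v ∉ scopeVars I H ∪ B → v ∉ J → coverCount I U v ≠ 1) →
      J.card ≤ ∑ j ∈ constraintSupport U \ H,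
        ((U j).filter fun i => (I j).2 i ∈ scopeVars I H ∪ B).card →
      constraintSupport U ⊆ H := by
    intro U hU hUr J hJ hJc
    have h1 := card_new_vars_le I (t := t) (U := U) (N := constraintSupport U \ H)
      (b := scopeVars I H ∪ B) (J := J)
      (fun j hj => hU j (mem_constraintSupport.mp (Finset.mem_sdiff.mp hj).1))
      (fun j hj i hi => by
        refine Finset.mem_union_left _ (mem_scopeVars.mpr ⟨j, ?_, i, rfl⟩)
        by_contra hjH
        refine hj (Finset.mem_sdiff.mpr ⟨mem_constraintSupport.mpr ?_, hjH⟩)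
        exact Finset.ne_empty_of_mem hi) hJ
    have hcard : (H ∪ constraintSupport U).card = H.card + (constraintSupport U \ H).card := by
      rw [← Finset.union_sdiff_self_eq_union, Finset.card_union_of_disjoint Finset.disjoint_sdiff]
    have hvars : (scopeVars I (H ∪ constraintSupport U) ∪ B).card ≤ (scopeVars I H ∪ B).card +
        (scopeVars I (constraintSupport U \ H) \ (scopeVars I H ∪ B)).card := by
      refine le_trans (Finset.card_le_card ?_) (Finset.card_union_le _ _)
      rw [← Finset.union_sdiff_self_eq_union (s := H), scopeVars_union]
      intro v hv
      simp only [Finset.mem_union, Finset.mem_sdiff] at hv ⊢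
      tauto
    have hmem : H ∪ constraintSupport U ∈ F := by
      refine Finset.mem_filter.mpr ⟨Finset.mem_univ _, ?_, ?_⟩
      · exact (Finset.card_union_le _ _).trans (by omega)
      · rw [hcard, mul_add, mul_add]
        omega
    have h2 := hmax _ hmem
    rw [hcard] at h2
    rw [← Finset.sdiff_eq_empty_iff_subset, ← Finset.card_eq_zero]
    omega
  refine ⟨H, hsmall, fun U hU hUr hev => ?_, fun U hU hUr w hev j hj i hi hb => ?_⟩
  · refine key U hU hUr ∅ (fun v hv _ h1 => ?_) (by simp)
    have := hev v hv
    rw [h1] at this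
    exact absurd this (by decide)
  · have hjU : j ∈ constraintSupport U := mem_constraintSupport.mpr (Finset.ne_empty_of_mem hi)
    refine hj (key U hU hUr {w} (fun v hv hvw h1 => ?_) ?_ hjU)
    · have := hev v hv (by simpa using hvw)
      rw [h1] at this
      exact absurd this (by decide)
    -- The coordinate `i`, which lies in the closed set, pays for the single exceptional variable
    -- `w`.
    · rw [Finset.card_singleton]
      refine le_trans ?_ (Finset.single_le_sum (f := fun j => ((U j).filter
        fun i => (I j).2 i ∈ scopeVars I H ∪ B).card) (fun _ _ => Nat.zero_le _)
        (Finset.mem_sdiff.mpr ⟨hjU, hj⟩))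
      exact Finset.card_pos.mpr ⟨i, Finset.mem_filter.mpr ⟨hi, hb⟩⟩

/-! ## The pseudo-expectation -/

/-- The product of the densities of all constraints, truncated to the Fourier terms that use at
most `r` constraints. -/
def truncatedDensity (μ : (Fin k → Bool) → ℝ) (I : Instance n k m) (r : ℕ) (x : Fin n → Bool) :
    ℝ := ∑ U with (constraintSupport U).card ≤ r, fourierTerm μ I U x

/-- The pseudo-expectation against the truncated density. -/
def pseudoExp (μ : (Fin k → Bool) → ℝ) (I : Instance n k m) (r : ℕ) :
    ((Fin n → Bool) → ℝ) →ₗ[ℝ] ℝ where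
  toFun f := (∑ x, f x * truncatedDensity μ I r x) / 2 ^ n
  map_add' f g := by
    simp only [Pi.add_apply, add_mul, Finset.sum_add_distrib, add_div]
  map_smul' a f := by
    simp only [Pi.smul_apply, smul_eq_mul, mul_assoc, ← Finset.mul_sum, mul_div_assoc,
      RingHom.id_apply]

lemma pseudoExp_apply (μ : (Fin k → Bool) → ℝ) (I : Instance n k m) (r : ℕ)
    (f : (Fin n → Bool) → ℝ) :
    pseudoExp μ I r f = (∑ x, f x * truncatedDensity μ I r x) / 2 ^ n := rfl

/-- `μ` is a probability distribution with vanishing Fourier coefficients on levels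
`1, …, t - 1`. -/
structure IsUniformDistribution (t : ℕ) (μ : (Fin k → Bool) → ℝ) : Prop where
  nonneg : ∀ z, 0 ≤ μ z
  sum_eq_one : ∑ z, μ z = 1
  fourierCoef_eq_zero : ∀ V : Finset (Fin k), V ≠ ∅ → V.card < t → fourierCoef μ V = 0

lemma IsUniformDistribution.admissible_of_fourierConst_ne_zero {t : ℕ}
    {μ : (Fin k → Bool) → ℝ} (hμ : IsUniformDistribution t μ) {I : Instance n k m}
    {U : Fin m → Finset (Fin k)} (h : fourierConst μ I U ≠ 0) : Admissible t U := by
  intro j hj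
  by_contra hlt
  refine h (Finset.prod_eq_zero (Finset.mem_univ j) ?_)
  rw [hμ.fourierCoef_eq_zero _ hj (not_le.mp hlt), zero_mul]

lemma DependsOn.mul_finset {f g : (Fin n → Bool) → ℝ} {s : Finset (Fin n)}
    (hf : DependsOn f (s : Set (Fin n))) (hg : DependsOn g (s : Set (Fin n))) :
    DependsOn (fun x => f x * g x) (s : Set (Fin n)) := fun _ _ h => by
  simp only [hf h, hg h]

lemma dependsOn_density (μ : (Fin k → Bool) → ℝ) (I : Instance n k m) (H : Finset (Fin m)) :
    DependsOn (fun x => ∏ j ∈ H, density μ (I j) x) (scopeVars I H : Set (Fin n)) := by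
  intro x y h
  refine Finset.prod_congr rfl fun j hj => ?_
  unfold density
  congr 2
  funext i
  rw [h _ (Finset.mem_coe.mpr (mem_scopeVars.mpr ⟨j, hj, i, rfl⟩))]

/-- On functions of few variables the pseudo-expectation is the expectation under an actual
density. -/
lemma pseudoExp_eq_of_closed {t r : ℕ} {μ : (Fin k → Bool) → ℝ} (hμ : IsUniformDistribution t μ)
    {I : Instance n k m} {b : Finset (Fin n)} {H H' : Finset (Fin m)}
    (hH : ∀ U, Admissible t U → (constraintSupport U).card ≤ r →
      (∀ v ∉ b, Even (coverCount I U v)) → constraintSupport U ⊆ H)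
    (hHH' : H ⊆ H') (hH' : H'.card ≤ r) {f : (Fin n → Bool) → ℝ}
    (hf : DependsOn f (b : Set (Fin n))) :
    pseudoExp μ I r f = (∑ x, f x * ∏ j ∈ H', density μ (I j) x) / 2 ^ n := by
  rw [pseudoExp_apply]
  congr 1
  simp only [prod_density_eq hμ.sum_eq_one, truncatedDensity, Finset.mul_sum]
  rw [Finset.sum_comm, Finset.sum_comm (s := Finset.univ (α := Fin n → Bool))]
  -- Terms not supported in `H` are orthogonal to `f`. Hence the truncated density and the full
  -- density of `H'` both reduce to the terms inside `H`.
  have hzero : ∀ U, (constraintSupport U).card ≤ r → ¬ constraintSupport U ⊆ H →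
      ∑ x, f x * fourierTerm μ I U x = 0 := by
    intro U hUr hUH
    simp only [fourierTerm_eq]
    by_cases hc : fourierConst μ I U = 0
    · simp [hc]
    have hnot : ¬ ∀ v ∉ b, Even (coverCount I U v) := fun h =>
      hUH (hH U (hμ.admissible_of_fourierConst_ne_zero hc) hUr h)
    push Not at hnot
    obtain ⟨v, hv, hodd⟩ := hnot
    have := sum_mul_signPow_eq_zero hf hv (Nat.not_even_iff_odd.mp hodd)
    calc ∑ x, f x * (fourierConst μ I U * signPow (coverCount I U) x)
        = fourierConst μ I U * ∑ x, f x * signPow (coverCount I U) x := by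
          rw [Finset.mul_sum]; exact Finset.sum_congr rfl fun x _ => by ring
      _ = 0 := by rw [this, mul_zero]
  trans ∑ U with constraintSupport U ⊆ H, ∑ x, f x * fourierTerm μ I U x
  · symm
    refine Finset.sum_subset (fun U hU => ?_) fun U hU hUH => ?_
    · simp only [Finset.mem_filter, Finset.mem_univ, true_and] at hU ⊢
      exact (Finset.card_le_card (hU.trans hHH')).trans hH'
    · simp only [Finset.mem_filter, Finset.mem_univ, true_and] at hU hUH
      exact hzero U hU hUH
  · refine Finset.sum_subset (fun U hU => ?_) fun U hU hUH => ?_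
    · simp only [Finset.mem_filter, Finset.mem_univ, true_and] at hU ⊢
      exact hU.trans hHH'
    · simp only [Finset.mem_filter, Finset.mem_univ, true_and] at hU hUH
      exact hzero U ((Finset.card_le_card hU).trans hH') hUH

lemma density_nonneg {t : ℕ} {μ : (Fin k → Bool) → ℝ} (hμ : IsUniformDistribution t μ)
    (C : Constraint n k) (x : Fin n → Bool) : 0 ≤ density μ C x :=
  mul_nonneg (by positivity) (hμ.nonneg _)

section Local

variable {t s r : ℕ} {μ : (Fin k → Bool) → ℝ} {δ : ℝ} {I : Instance n k m}

lemma pseudoExp_nonneg (hμ : IsUniformDistribution t μ) (hδ : 0 < δ)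
    (hI : Expanding I (k - t / 2 + δ) s) (hrs : 2 * r ≤ s) {B : Finset (Fin n)}
    (hB : (B.card : ℝ) ≤ δ * r) {f : (Fin n → Bool) → ℝ} (hf : DependsOn f (B : Set (Fin n)))
    (hf0 : ∀ x, 0 ≤ f x) : 0 ≤ pseudoExp μ I r f := by
  obtain ⟨H, hHc, h1, -⟩ := exists_closure hδ hI hrs hB
  have hHr : H.card ≤ r := by
    have : (H.card : ℝ) ≤ r := le_of_mul_le_mul_left (hHc.trans hB) hδ
    exact_mod_cast this
  rw [pseudoExp_eq_of_closed hμ h1 subset_rfl hHr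
    (hf.mono (by simp))]
  refine div_nonneg (Finset.sum_nonneg fun x _ => mul_nonneg (hf0 x) ?_) (by positivity)
  exact Finset.prod_nonneg fun j _ => density_nonneg hμ _ _

/-- The closure may be enlarged by the constraint `l` itself without changing the value. The density
then vanishes wherever `f` may be negative. -/
lemma pseudoExp_nonneg_of_constraint (hμ : IsUniformDistribution t μ) (hδ : 0 < δ)
    (hI : Expanding I (k - t / 2 + δ) s) (hrs : 2 * r ≤ s) {B : Finset (Fin n)}
    (hB : (B.card : ℝ) ≤ δ * (r - 1)) {f : (Fin n → Bool) → ℝ}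
    (hf : DependsOn f (B : Set (Fin n))) (l : Fin m)
    (hf0 : ∀ x, μ (fun i => xor (x ((I l).2 i)) ((I l).1 i)) ≠ 0 → 0 ≤ f x) :
    0 ≤ pseudoExp μ I r f := by
  obtain ⟨H, hHc, h1, -⟩ := exists_closure hδ hI hrs (hB.trans (by nlinarith))
  have hHr : (insert l H).card ≤ r := by
    have : (H.card : ℝ) ≤ r - 1 := le_of_mul_le_mul_left (hHc.trans hB) hδ
    have h2 : ((insert l H).card : ℝ) ≤ H.card + 1 := by exact_mod_cast Finset.card_insert_le _ _
    have h3 : ((insert l H).card : ℝ) ≤ r := by linarith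
    exact_mod_cast h3
  rw [pseudoExp_eq_of_closed hμ h1 (Finset.subset_insert l H) hHr (hf.mono (by simp))]
  refine div_nonneg (Finset.sum_nonneg fun x _ => ?_) (by positivity)
  by_cases hx : μ (fun i => xor (x ((I l).2 i)) ((I l).1 i)) = 0
  · rw [Finset.prod_eq_zero (Finset.mem_insert_self l H) (by simp [density, hx]), mul_zero]
  · exact mul_nonneg (hf0 x hx) (Finset.prod_nonneg fun j _ => density_nonneg hμ _ _)

/-- The closure of the empty set of variables has at most `0 / δ` constraints, so only the constant
Fourier term survives. -/
lemma pseudoExp_one (hμ : IsUniformDistribution t μ) (hδ : 0 < δ)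
    (hI : Expanding I (k - t / 2 + δ) s) (hrs : 2 * r ≤ s) :
    pseudoExp μ I r (fun _ => 1) = 1 := by
  obtain ⟨H, hHc, h1, -⟩ := exists_closure (B := ∅) hδ hI hrs
    (by simp only [Finset.card_empty, Nat.cast_zero]; positivity)
  have hH0 : H = ∅ := by
    rw [← Finset.card_eq_zero]
    have : (H.card : ℝ) ≤ 0 := by
      by_contra hc
      have := mul_pos hδ (not_le.mp hc)
      simp only [Finset.card_empty, Nat.cast_zero] at hHc
      linarith
    exact_mod_cast le_antisymm this (by positivity)
  rw [pseudoExp_eq_of_closed hμ h1 subset_rfl (by simp [hH0]) (fun _ _ _ => rfl)]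
  simp [hH0]

/-- Around every small set of variables there is a small set `b` such that, for every variable `w`
outside `b`, the sign of `w` is pseudo-independent of the variables in `b`. -/
lemma exists_separator (hμ : IsUniformDistribution t μ) (hδ : 0 < δ)
    (hI : Expanding I (k - t / 2 + δ) s) (hrs : 2 * r ≤ s) {B : Finset (Fin n)}
    (hB : (2 + k / δ) * B.card + 1 ≤ δ * r) :
    ∃ b : Finset (Fin n), B ⊆ b ∧ (b.card : ℝ) ≤ (1 + k / δ) * B.card ∧
      ∀ w ∉ b, ∃ c : ℝ, ∀ f : (Fin n → Bool) → ℝ, DependsOn f (b : Set (Fin n)) →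
        pseudoExp μ I r (fun x => f x * boolSign (x w)) = c * pseudoExp μ I r f := by
  have hkδ : (0 : ℝ) ≤ k / δ := by positivity
  have hBr : (B.card : ℝ) ≤ δ * r := by
    have : (0 : ℝ) ≤ k / δ * B.card := by positivity
    linarith
  obtain ⟨H, hHc, h1, h2⟩ := exists_closure hδ hI hrs hBr
  have hHr : H.card ≤ r := by
    have : (H.card : ℝ) ≤ r := le_of_mul_le_mul_left (hHc.trans hBr) hδ
    exact_mod_cast this
  set b := scopeVars I H ∪ B with hb
  have hbc : (b.card : ℝ) ≤ (1 + k / δ) * B.card := by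
    have h3 : (b.card : ℝ) ≤ k * H.card + B.card := by
      exact_mod_cast (Finset.card_union_le _ _).trans
        (Nat.add_le_add_right (card_scopeVars_le I H) _)
    have h4 : (k : ℝ) * H.card ≤ k / δ * B.card := by
      rw [div_mul_eq_mul_div, le_div_iff₀ hδ]
      nlinarith [mul_le_mul_of_nonneg_left hHc (Nat.cast_nonneg (α := ℝ) k)]
    linarith
  refine ⟨b, Finset.subset_union_right, hbc, fun w hw => ?_⟩
  have hBw : ((insert w b).card : ℝ) ≤ δ * r := by
    have : ((insert w b).card : ℝ) ≤ b.card + 1 := by exact_mod_cast Finset.card_insert_le _ _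
    linarith
  obtain ⟨H₂, hH₂c, h3, -⟩ := exists_closure hδ hI hrs hBw
  -- The bound `hB` is made for this: `δ |H| ≤ |B|` and `δ |H₂| ≤ |b| + 1 ≤ (1 + k / δ) |B| + 1`.
  have hHr' : (H ∪ H₂).card ≤ r := by
    have h4 : ((H ∪ H₂).card : ℝ) ≤ H.card + H₂.card := by exact_mod_cast Finset.card_union_le _ _
    have h5 : ((insert w b).card : ℝ) ≤ b.card + 1 := by exact_mod_cast Finset.card_insert_le _ _
    have : ((H ∪ H₂).card : ℝ) ≤ r := by
      refine le_of_mul_le_mul_left ?_ hδ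
      nlinarith [mul_le_mul_of_nonneg_left h4 hδ.le]
    exact_mod_cast this
  classical
  -- Keep the densities of `H` as part of `G`, which depends only on `b`, and expand those of `H₂ \
  -- H`. The constant collects the terms whose character, times the sign of `w`, is trivial; it does
  -- not involve `f`.
  refine ⟨∑ U with constraintSupport U ⊆ H₂ \ H,
    if ∀ v, Even ((coverCount I U + Pi.single w 1 : Fin n → ℕ) v) then fourierConst μ I U else 0,
    fun f hf => ?_⟩
  have hfw : DependsOn (fun x => f x * boolSign (x w)) (insert w b : Finset (Fin n)) := by
    intro x y hxy
    have e1 : f x = f y := hf fun i hi => hxy i (by simp [Finset.mem_coe.mp hi])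
    simp only [e1, hxy w (by simp)]
  rw [pseudoExp_eq_of_closed hμ h3 Finset.subset_union_right hHr'
      (hfw.mono (Finset.coe_subset.mpr Finset.subset_union_right)),
    pseudoExp_eq_of_closed hμ h1 subset_rfl hHr hf, ← mul_div_assoc]
  congr 1
  set G : (Fin n → Bool) → ℝ := fun x => f x * ∏ j ∈ H, density μ (I j) x with hG
  have hGb : DependsOn G (b : Set (Fin n)) :=
    DependsOn.mul_finset hf ((dependsOn_density μ I H).mono (by simp [hb]))
  have hprod : ∀ x, f x * boolSign (x w) * ∏ j ∈ H ∪ H₂, density μ (I j) x =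
      ∑ U with constraintSupport U ⊆ H₂ \ H,
        fourierConst μ I U * (G x * signPow (coverCount I U + Pi.single w 1) x) := by
    intro x
    rw [← Finset.union_sdiff_self_eq_union, Finset.prod_union Finset.disjoint_sdiff,
      prod_density_eq hμ.sum_eq_one I (H₂ \ H), hG, Finset.mul_sum, Finset.mul_sum]
    refine Finset.sum_congr rfl fun U _ => ?_
    rw [fourierTerm_eq, signPow_add, signPow_single]
    ring
  simp only [hprod]
  rw [Finset.sum_comm, Finset.sum_mul]
  refine Finset.sum_congr rfl fun U hU => ?_
  have hUsub : constraintSupport U ⊆ H₂ \ H := (Finset.mem_filter.mp hU).2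
  rw [← Finset.mul_sum]
  split_ifs with hev
  · simp only [signPow_of_even hev, mul_one, hG]
  rw [zero_mul]
  by_cases hc : fourierConst μ I U = 0
  · rw [hc, zero_mul]
  -- A nontrivial character has an odd variable outside `b`. Otherwise `w` would be the only
  -- possible odd variable of `U` outside `b`, and the second closure property would keep `U` away
  -- from `b` altogether, making the character trivial.
  have hex : ∃ v ∉ b, Odd ((coverCount I U + Pi.single w 1 : Fin n → ℕ) v) := by
    by_contra hno
    push Not at hno
    refine hev fun v => ?_
    by_cases hv : v ∈ b
    · have hvw : v ≠ w := fun h => hw (h ▸ hv)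
      have hzero : coverCount I U v = 0 := by
        refine Finset.sum_eq_zero fun j _ => ?_
        rw [Finset.card_eq_zero, Finset.filter_eq_empty_iff]
        intro i hi hiv
        have hjH : j ∉ H := (Finset.mem_sdiff.mp (hUsub (mem_constraintSupport.mpr
          (Finset.ne_empty_of_mem hi)))).2
        refine h2 U (hμ.admissible_of_fourierConst_ne_zero hc)
          ((Finset.card_le_card hUsub).trans ((Finset.card_le_card
            (Finset.sdiff_subset.trans Finset.subset_union_right)).trans hHr')) w
          (fun v' hv' hvw' => ?_) j hjH i hi (hiv ▸ hv)
        have := Nat.not_odd_iff_even.mp (hno v' hv')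
        simpa [hvw'] using this
      simp [hzero, hvw]
    · exact Nat.not_odd_iff_even.mp (hno v hv)
  obtain ⟨v, hv, hodd⟩ := hex
  rw [sum_mul_signPow_eq_zero hGb hv hodd, mul_zero]

end Local

/-! ## Positivity of squares of affine functions -/

/-- A quadratic form that is nonnegative on separated blocks covering the index set is
nonnegative. -/
lemma sum_sum_nonneg_of_blocks {ι : Type*} (M : ι → ι → ℝ)
    (hM : ∀ i, ∃ b : Finset ι, i ∈ b ∧ (∀ i' ∈ b, ∀ j ∉ b, M i' j = 0 ∧ M j i' = 0) ∧
      ∀ S ⊆ b, 0 ≤ ∑ i ∈ S, ∑ j ∈ S, M i j) (S : Finset ι) :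
    0 ≤ ∑ i ∈ S, ∑ j ∈ S, M i j := by
  classical
  -- The blocks may overlap. Removing one block at a time from `S` never requires them to be
  -- disjoint.
  induction S using Finset.strongInduction with
  | H S ih =>
    rcases S.eq_empty_or_nonempty with rfl | ⟨i, hi⟩
    · simp
    obtain ⟨b, hib, hcross, hb⟩ := hM i
    have h1 := hb (S.filter (· ∈ b)) (fun j hj => (Finset.mem_filter.mp hj).2)
    have h2 := ih (S.filter (· ∉ b)) (Finset.filter_ssubset.mpr ⟨i, hi, by simpa using hib⟩)
    have hsplit : ∀ i', ∑ j ∈ S, M i' j =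
        ∑ j ∈ S.filter (· ∈ b), M i' j + ∑ j ∈ S.filter (· ∉ b), M i' j := fun i' =>
      (Finset.sum_filter_add_sum_filter_not S (· ∈ b) _).symm
    rw [← Finset.sum_filter_add_sum_filter_not S (· ∈ b)]
    simp only [hsplit]
    rw [Finset.sum_congr rfl (g := fun i' => ∑ j ∈ S.filter (· ∈ b), M i' j)
        (s₁ := S.filter (· ∈ b)),
      Finset.sum_congr rfl (g := fun i' => ∑ j ∈ S.filter (· ∉ b), M i' j)
        (s₁ := S.filter (· ∉ b))]
    · exact add_nonneg h1 h2
    · intro i' hi'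
      rw [Finset.sum_eq_zero (s := S.filter (· ∈ b)), zero_add]
      exact fun j hj => (hcross j (Finset.mem_filter.mp hj).2 i' (Finset.mem_filter.mp hi').2).2
    · intro i' hi'
      rw [Finset.sum_eq_zero (s := S.filter (· ∉ b)), add_zero]
      exact fun j hj => (hcross i' (Finset.mem_filter.mp hi').2 j (Finset.mem_filter.mp hj).2).1

lemma sum_sum_mul_sub_mul {ι : Type*} (S : Finset ι) (c u : ι → ℝ) (M : ι → ι → ℝ) (p : ℝ) :
    ∑ i ∈ S, ∑ j ∈ S, c i * c j * (p * M i j - u i * u j) =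
      p * (∑ i ∈ S, ∑ j ∈ S, c i * c j * M i j) -
        (∑ i ∈ S, c i * u i) * ∑ i ∈ S, c i * u i := by
  rw [Finset.sum_mul_sum, Finset.mul_sum, ← Finset.sum_sub_distrib]
  refine Finset.sum_congr rfl fun i _ => ?_
  rw [Finset.mul_sum, ← Finset.sum_sub_distrib]
  exact Finset.sum_congr rfl fun j _ => by ring

lemma linearMap_mul_sq_affine (E : ((Fin n → Bool) → ℝ) →ₗ[ℝ] ℝ) (g : (Fin n → Bool) → ℝ)
    (a : ℝ) (c : Fin n → ℝ) (S : Finset (Fin n)) :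
    E (fun x => g x * (a + ∑ i ∈ S, c i * boolSign (x i)) ^ 2) =
      a ^ 2 * E g + 2 * a * ∑ i ∈ S, c i * E (fun x => g x * boolSign (x i)) +
      ∑ i ∈ S, ∑ j ∈ S, c i * c j * E (fun x => g x * boolSign (x i) * boolSign (x j)) := by
  have h : (fun x => g x * (a + ∑ i ∈ S, c i * boolSign (x i)) ^ 2) =
      a ^ 2 • g + (2 * a) • ∑ i ∈ S, c i • (fun x => g x * boolSign (x i)) +
      ∑ i ∈ S, ∑ j ∈ S, (c i * c j) • (fun x => g x * boolSign (x i) * boolSign (x j)) := by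
    funext x
    simp only [Pi.add_apply, Pi.smul_apply, smul_eq_mul, Finset.sum_apply]
    have h1 : ∑ i ∈ S, c i * (g x * boolSign (x i)) = g x * ∑ i ∈ S, c i * boolSign (x i) := by
      rw [Finset.mul_sum]; exact Finset.sum_congr rfl fun i _ => by ring
    have h2 : ∑ i ∈ S, ∑ j ∈ S, c i * c j * (g x * boolSign (x i) * boolSign (x j)) =
        g x * ((∑ i ∈ S, c i * boolSign (x i)) * ∑ i ∈ S, c i * boolSign (x i)) := by
      rw [Finset.sum_mul_sum, Finset.mul_sum]
      refine Finset.sum_congr rfl fun i _ => ?_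
      rw [Finset.mul_sum]; exact Finset.sum_congr rfl fun j _ => by ring
    rw [h1, h2]; ring
  rw [h]
  simp only [map_add, map_smul, map_sum, smul_eq_mul]

lemma dependsOn_boolSign (i : Fin n) {s : Finset (Fin n)} (hi : i ∈ s) :
    DependsOn (fun x : Fin n → Bool => boolSign (x i)) (s : Set (Fin n)) := fun _ _ h => by
  simp only [h i (Finset.mem_coe.mpr hi)]

/-- Multiplied by `E g`, the value is `(a E[g] + ∑ c_i E[g x_i])²` plus the quadratic form of the
conditional covariance matrix, with `x_i` the signs. Separators make that form block-decomposable,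
although the square involves all variables. -/
lemma pseudoExp_mul_sq_nonneg {t s r : ℕ} {μ : (Fin k → Bool) → ℝ} {δ : ℝ} {I : Instance n k m}
    (hμ : IsUniformDistribution t μ) (hδ : 0 < δ) (hI : Expanding I (k - t / 2 + δ) s)
    (hrs : 2 * r ≤ s) {T : Finset (Fin n)} (hT : (2 + k / δ) * (T.card + 1) + 1 ≤ δ * r)
    {g : (Fin n → Bool) → ℝ} (hg : DependsOn g (T : Set (Fin n))) (hg0 : ∀ x, 0 ≤ g x)
    (a : ℝ) (c : Fin n → ℝ) :
    0 ≤ pseudoExp μ I r (fun x => g x * (a + ∑ i, c i * boolSign (x i)) ^ 2) := by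
  set E := pseudoExp μ I r with hE
  have hkδ : (0 : ℝ) ≤ k / δ := by positivity
  have hblock : 0 ≤ ∑ i, ∑ j, c i * c j * (E g * E (fun x => g x * boolSign (x i) * boolSign (x j))
      - E (fun x => g x * boolSign (x i)) * E (fun x => g x * boolSign (x j))) := by
    refine sum_sum_nonneg_of_blocks (fun i j => c i * c j * (E g *
      E (fun x => g x * boolSign (x i) * boolSign (x j))
      - E (fun x => g x * boolSign (x i)) * E (fun x => g x * boolSign (x j)))) (fun i₀ => ?_) _
    have hins : ((insert i₀ T).card : ℝ) ≤ T.card + 1 := by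
      exact_mod_cast Finset.card_insert_le _ _
    obtain ⟨b, hBb, hbc, hsep⟩ := exists_separator hμ hδ hI hrs (B := insert i₀ T) (by nlinarith)
    have hTb : T ⊆ b := (Finset.subset_insert _ _).trans hBb
    have hgb : DependsOn g (b : Set (Fin n)) := hg.mono (Finset.coe_subset.mpr hTb)
    refine ⟨b, hBb (Finset.mem_insert_self _ _), fun i hi j hj => ?_, fun S hS => ?_⟩
    · obtain ⟨κ, hκ⟩ := hsep j hj
      have h1 := hκ g hgb
      have h2 := hκ _ (DependsOn.mul_finset hgb (dependsOn_boolSign i hi))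
      have h3 : (fun x : Fin n → Bool => g x * boolSign (x j) * boolSign (x i)) =
          fun x => g x * boolSign (x i) * boolSign (x j) := by funext x; ring
      rw [h3, h1, h2]
      constructor <;> ring
    · have hbr : (b.card : ℝ) ≤ δ * r := by nlinarith
      -- Local positivity for every constant shift `y` gives a nonnegative quadratic in `y`. Its
      -- discriminant bound is the Cauchy–Schwarz inequality needed on the block.
      have hq : ∀ y : ℝ, 0 ≤ E g * (y * y) + (2 * ∑ i ∈ S, c i * E (fun x => g x * boolSign (x i)))
          * y + ∑ i ∈ S, ∑ j ∈ S, c i * c j * E (fun x => g x * boolSign (x i) * boolSign (x j)) := by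
        intro y
        have h1 : 0 ≤ E (fun x => g x * (y + ∑ i ∈ S, c i * boolSign (x i)) ^ 2) := by
          refine pseudoExp_nonneg hμ hδ hI hrs hbr (DependsOn.mul_finset hgb fun x x' h => ?_)
            fun x => mul_nonneg (hg0 x) (sq_nonneg _)
          have : ∀ i ∈ S, c i * boolSign (x i) = c i * boolSign (x' i) := fun i hi => by
            rw [h i (Finset.mem_coe.mpr (hS hi))]
          simp only [Finset.sum_congr rfl this]
        rw [linearMap_mul_sq_affine] at h1
        linarith
      have hd := discrim_le_zero hq
      unfold discrim at hd
      rw [sum_sum_mul_sub_mul]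
      nlinarith
  have hlocal : ∀ i j, ∀ f : (Fin n → Bool) → ℝ,
      DependsOn f (insert i (insert j T) : Finset (Fin n)) → (∀ x, 0 ≤ f x) → 0 ≤ E f := by
    intro i j f hf hf0
    refine pseudoExp_nonneg hμ hδ hI hrs ?_ hf hf0
    have h1 : ((insert i (insert j T)).card : ℝ) ≤ T.card + 2 := by
      exact_mod_cast (Finset.card_insert_le _ _).trans
        (Nat.add_le_add_right (Finset.card_insert_le _ _) 1)
    nlinarith [Nat.cast_nonneg (α := ℝ) T.card]
  rw [linearMap_mul_sq_affine]
  have hp : 0 ≤ E g := by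
    refine pseudoExp_nonneg hμ hδ hI hrs ?_ hg hg0
    nlinarith [Nat.cast_nonneg (α := ℝ) T.card]
  rcases hp.eq_or_lt with hp | hp
  -- If `E g = 0`, then `g (1 ± f) ≥ 0` squeezes the pseudo-expectation of `g f` to zero for every
  -- local `f` with values `±1`, so every term vanishes.
  · have hzero : ∀ i j, ∀ f : (Fin n → Bool) → ℝ,
        DependsOn f (insert i (insert j T) : Finset (Fin n)) → (∀ x, |f x| = 1) →
        E (fun x => g x * f x) = 0 := by
      intro i j f hf hf1
      have hgT : DependsOn g (insert i (insert j T) : Finset (Fin n)) :=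
        hg.mono (Finset.coe_subset.mpr
          ((Finset.subset_insert j T).trans (Finset.subset_insert i _)))
      have h1 := hlocal i j (fun x => g x * (1 + f x))
        (DependsOn.mul_finset hgT fun x y h => by simp only [hf h])
        fun x => mul_nonneg (hg0 x) (by linarith [neg_abs_le (f x), hf1 x])
      have h2 := hlocal i j (fun x => g x * (1 - f x))
        (DependsOn.mul_finset hgT fun x y h => by simp only [hf h])
        fun x => mul_nonneg (hg0 x) (by linarith [le_abs_self (f x), hf1 x])
      have h3 : (fun x => g x * (1 + f x)) = g + fun x => g x * f x := by
        funext x; simp only [Pi.add_apply]; ring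
      have h4 : (fun x => g x * (1 - f x)) = g - fun x => g x * f x := by
        funext x; simp only [Pi.sub_apply]; ring
      rw [h3, map_add, ← hp] at h1
      rw [h4, map_sub, ← hp] at h2
      linarith
    have h1 : ∀ i, E (fun x => g x * boolSign (x i)) = 0 := fun i =>
      hzero i i _ (dependsOn_boolSign i (by simp)) fun x => abs_boolSign _
    have h2 : ∀ i j, E (fun x => g x * boolSign (x i) * boolSign (x j)) = 0 := by
      intro i j
      have := hzero i j (fun x => boolSign (x i) * boolSign (x j))
        (DependsOn.mul_finset (dependsOn_boolSign i (by simp)) (dependsOn_boolSign j (by simp)))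
        fun x => by rw [abs_mul, abs_boolSign, abs_boolSign, one_mul]
      simpa only [mul_assoc] using this
    simp [h1, h2, ← hp]
  · refine nonneg_of_mul_nonneg_right ?_ hp
    rw [sum_sum_mul_sub_mul] at hblock
    nlinarith [sq_nonneg (a * E g + ∑ i, c i * E (fun x => g x * boolSign (x i)))]

end RandomCSP

end

noncomputable section

namespace RandomCSP

open MvPolynomial

variable {n k m : ℕ}

/-! ## Polynomials on the cube -/

/-- The restriction of a polynomial to the cube `{0,1}^n`. -/
def cubeEval : RPoly n →+* ((Fin n → Bool) → ℝ) :=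
  RingHom.pi fun x => eval fun i => if x i then (1 : ℝ) else 0

lemma cubeEval_apply (p : RPoly n) (x : Fin n → Bool) :
    cubeEval p x = eval (fun i => if x i then (1 : ℝ) else 0) p := rfl

lemma cubeEval_C (a : ℝ) (x : Fin n → Bool) : cubeEval (C a : RPoly n) x = a := by
  simp [cubeEval_apply]

lemma cubeEval_X (i : Fin n) (x : Fin n → Bool) :
    cubeEval (X i : RPoly n) x = if x i then 1 else 0 := by
  simp [cubeEval_apply]

lemma cubeEval_monomial (s : Fin n →₀ ℕ) (a : ℝ) (x : Fin n → Bool) :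
    cubeEval (monomial s a : RPoly n) x = a * ∏ i, (if x i then (1 : ℝ) else 0) ^ s i := by
  rw [cubeEval_apply, eval_monomial, Finsupp.prod_fintype _ _ (by simp)]

lemma cubeEval_multilinearize (p : RPoly n) : cubeEval (multilinearize p) = cubeEval p := by
  conv_rhs => rw [p.as_sum]
  rw [multilinearize, map_sum, map_sum]
  refine Finset.sum_congr rfl fun s _ => ?_
  funext x
  rw [cubeEval_monomial, cubeEval_monomial]
  congr 1
  refine Finset.prod_congr rfl fun i _ => ?_
  rw [Finsupp.mapRange_apply]
  rcases Nat.eq_zero_or_pos (s i) with h | h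
  · simp [h]
  · rw [min_eq_right h, pow_one]
    split_ifs
    · simp
    · rw [zero_pow h.ne']

lemma cubeEval_signed (b : Bool) (i : Fin n) (x : Fin n → Bool) :
    cubeEval (signed b (X i) : RPoly n) x = if xor (x i) b then 1 else 0 := by
  cases b
  · simp [signed, cubeEval_X]
  · cases h : x i <;> simp [signed, cubeEval_X, h]

/-- The indicator function of `x_T = α`. -/
def cubeIndicator (T : Finset (Fin n)) (α x : Fin n → Bool) : ℝ := if ∀ i ∈ T, x i = α i then 1 else 0

lemma cubeIndicator_nonneg (T : Finset (Fin n)) (α x : Fin n → Bool) :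
    0 ≤ cubeIndicator T α x := by
  unfold cubeIndicator; split_ifs <;> norm_num

lemma cubeIndicator_empty (α x : Fin n → Bool) : cubeIndicator ∅ α x = 1 := by
  simp [cubeIndicator]

lemma dependsOn_cubeIndicator (T : Finset (Fin n)) (α : Fin n → Bool) :
    DependsOn (cubeIndicator T α) (T : Set (Fin n)) := by
  intro x y h
  have : (∀ i ∈ T, x i = α i) ↔ ∀ i ∈ T, y i = α i :=
    forall₂_congr fun i hi => by rw [h i (Finset.mem_coe.mpr hi)]
  simp only [cubeIndicator, this]

lemma cubeEval_indicatorPoly (T : Finset (Fin n)) (α x : Fin n → Bool) :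
    cubeEval (indicatorPoly T α) x = cubeIndicator T α x := by
  rw [indicatorPoly, map_prod, Finset.prod_apply, cubeIndicator]
  simp only [cubeEval_signed]
  split_ifs with h
  · exact Finset.prod_eq_one fun i hi => by simp [h i hi]
  · push Not at h
    obtain ⟨i, hi, hne⟩ := h
    refine Finset.prod_eq_zero hi ?_
    cases h1 : x i <;> cases h2 : α i <;> simp_all

lemma cubeIndicator_mul_eq (T : Finset (Fin n)) (α : Fin n → Bool) (i : Fin n) (β : Bool)
    (x : Fin n → Bool) : cubeIndicator T α x * (if x i = β then 1 else 0) =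
      if i ∈ T then (if α i = β then cubeIndicator T α x else 0)
      else cubeIndicator (insert i T) (Function.update α i β) x := by
  by_cases hi : i ∈ T
  · rw [if_pos hi]
    by_cases hx : ∀ j ∈ T, x j = α j
    · simp [cubeIndicator, hx i hi]
    · simp [cubeIndicator, hx]
  · rw [if_neg hi]
    have h1 : (∀ j ∈ insert i T, x j = Function.update α i β j) ↔
        (∀ j ∈ T, x j = α j) ∧ x i = β := by
      rw [Finset.forall_mem_insert, Function.update_self, and_comm]
      refine and_congr_left fun _ => forall₂_congr fun j hj => ?_
      rw [Function.update_of_ne (fun h : j = i => hi (h ▸ hj))]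
    simp only [cubeIndicator, h1, ite_and, mul_ite, mul_one, mul_zero]
    split_ifs <;> rfl

lemma cubeEval_constraintPoly (P : Predicate k) (Q : Constraint n k) (x : Fin n → Bool) :
    cubeEval (constraintPoly P Q) x = if P fun i => xor (x (Q.2 i)) (Q.1 i) then 1 else 0 := by
  have h1 : cubeEval (constraintPoly P Q) x =
      cubeEval (predPoly P) fun i => xor (x (Q.2 i)) (Q.1 i) := by
    have h2 : ∀ i, eval (fun i => if x i then (1 : ℝ) else 0)
        (signed (Q.1 i) (X (Q.2 i) : RPoly n)) = if xor (x (Q.2 i)) (Q.1 i) then 1 else 0 :=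
      fun i => cubeEval_signed (Q.1 i) (Q.2 i) x
    have h3 : ∀ (f : Fin n → ℝ) (g : Fin k → RPoly n) (p : RPoly k),
        eval f (aeval g p) = eval (fun i => eval f (g i)) p := by
      intro f g p
      induction p using MvPolynomial.induction_on with
      | C a => simp
      | add p q hp hq => rw [map_add, map_add, map_add, hp, hq]
      | mul_X p i hp => rw [map_mul, map_mul, map_mul, hp, aeval_X, eval_X]
    rw [cubeEval_apply, cubeEval_apply, constraintPoly, h3]
    simp only [h2]
  rw [h1, predPoly, map_sum, Finset.sum_apply]
  simp only [cubeEval_indicatorPoly, cubeIndicator, Finset.mem_univ, forall_true_left]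
  simp only [← _root_.funext_iff]
  rw [Finset.sum_ite_eq]
  simp

lemma exists_affine_of_totalDegree_le_one {p : RPoly n} (hp : p.totalDegree ≤ 1) :
    ∃ (a : ℝ) (c : Fin n → ℝ), ∀ x, cubeEval p x = a + ∑ i, c i * boolSign (x i) := by
  have hmon : ∀ s ∈ p.support, ∃ (a : ℝ) (c : Fin n → ℝ), ∀ x,
      cubeEval (monomial s (p.coeff s)) x = a + ∑ i, c i * boolSign (x i) := by
    intro s hs
    have hdeg : s.degree ≤ 1 := (le_totalDegree hs).trans hp
    rcases Nat.le_one_iff_eq_zero_or_eq_one.mp hdeg with h | h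
    · refine ⟨p.coeff s, 0, fun x => ?_⟩
      rw [(Finsupp.degree_eq_zero_iff s).mp h, cubeEval_monomial]
      simp
    · rw [Finsupp.degree_eq_sum] at h
      obtain ⟨i, -, hi⟩ := Finset.exists_ne_zero_of_sum_ne_zero (h.trans_ne one_ne_zero)
      have hsplit := Finset.add_sum_erase Finset.univ s (Finset.mem_univ i)
      have hzero : ∀ j, j ≠ i → s j = 0 := fun j hj => by
        have := Finset.single_le_sum (f := s) (fun _ _ => Nat.zero_le _)
          (Finset.mem_erase.mpr ⟨hj, Finset.mem_univ j⟩)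
        omega
      have hone : s i = 1 := by
        have := Finset.single_le_sum (f := s) (fun _ _ => Nat.zero_le _) (Finset.mem_univ i)
        omega
      refine ⟨p.coeff s / 2, Pi.single i (-(p.coeff s / 2)), fun x => ?_⟩
      rw [cubeEval_monomial, Finset.prod_eq_single i (fun j _ hj => by rw [hzero j hj, pow_zero])
        (by simp), hone, pow_one, Finset.sum_eq_single i (fun j _ hj => by simp [hj]) (by simp),
        Pi.single_eq_same]
      cases x i <;> simp [boolSign]
  choose! a c hac using hmon
  refine ⟨∑ s ∈ p.support, a s, fun i => ∑ s ∈ p.support, c s i, fun x => ?_⟩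
  conv_lhs => rw [p.as_sum]
  rw [map_sum, Finset.sum_apply, Finset.sum_congr rfl fun s hs => hac s hs x,
    Finset.sum_add_distrib, Finset.sum_comm]
  simp only [Finset.sum_mul]

lemma exists_affine_of_mlDegree_le_one {p : RPoly n} (hp : mlDegree p ≤ 1) :
    ∃ (a : ℝ) (c : Fin n → ℝ), ∀ x, cubeEval p x = a + ∑ i, c i * boolSign (x i) := by
  rw [← cubeEval_multilinearize]
  exact exists_affine_of_totalDegree_le_one hp

lemma signPow_ne_zero (e : Fin n → ℕ) (x : Fin n → Bool) : signPow e x ≠ 0 :=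
  Finset.prod_ne_zero_iff.mpr fun _ _ => pow_ne_zero _ fun h => by
    have := abs_boolSign (x ‹_›)
    rw [h, abs_zero] at this
    exact zero_ne_one this

/-- A polynomial that vanishes on the cube outside a subcube of codimension `|T|` has multilinear
degree at least `|T|`, unless it vanishes on the whole cube. -/
lemma cubeEval_eq_zero_of_mlDegree_lt {q : RPoly n} {T : Finset (Fin n)} {α : Fin n → Bool}
    (hq : ∀ x, ¬ (∀ i ∈ T, x i = α i) → cubeEval q x = 0) (h : mlDegree q < T.card) :
    cubeEval q = 0 := by
  funext y
  by_cases hy : ∀ i ∈ T, y i = α i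
  swap
  · exact hq y hy
  set e : Fin n → ℕ := fun i => if i ∈ T then 1 else 0 with he
  -- Fix the coordinates outside `T` as in `y` and pair with the full character on `T`. Each
  -- monomial of the reduction misses some variable of `T`, so it is killed; on the other hand `y`
  -- is the only point of this face where `q` can be nonzero.
  have h0 : ∑ x, cubeIndicator Tᶜ y x * cubeEval q x * signPow e x = 0 := by
    have hexp : ∀ x, cubeIndicator Tᶜ y x * cubeEval q x * signPow e x =
        ∑ s ∈ (multilinearize q).support, cubeIndicator Tᶜ y x *
          cubeEval (monomial s ((multilinearize q).coeff s)) x * signPow e x := by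
      intro x
      rw [← cubeEval_multilinearize]
      conv_lhs => rw [(multilinearize q).as_sum]
      rw [map_sum, Finset.sum_apply, Finset.mul_sum, Finset.sum_mul]
    simp only [hexp]
    rw [Finset.sum_comm]
    refine Finset.sum_eq_zero fun s hs => ?_
    obtain ⟨i, hiT, hi⟩ : ∃ i ∈ T, s i = 0 := by
      by_contra hno
      push Not at hno
      have h1 : T.card ≤ ∑ i ∈ T, s i := by
        have := Finset.card_nsmul_le_sum T s 1 fun i hi => Nat.one_le_iff_ne_zero.mpr (hno i hi)
        simpa using this
      have h2 : ∑ i ∈ T, s i ≤ s.degree := by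
        rw [Finsupp.degree_eq_sum]
        exact Finset.sum_le_sum_of_subset (Finset.subset_univ T)
      have h3 : s.degree ≤ mlDegree q := le_totalDegree hs
      omega
    refine sum_mul_signPow_eq_zero (b := {i}ᶜ) ?_ (v := i) (by simp) (by simp [he, hiT])
    refine DependsOn.mul_finset ((dependsOn_cubeIndicator Tᶜ y).mono ?_) fun x x' hx => ?_
    · intro j hj
      simp only [Finset.coe_compl, Set.mem_compl_iff, Finset.mem_coe, Finset.coe_singleton,
        Set.mem_singleton_iff] at hj ⊢
      exact fun hji => hj (hji ▸ hiT)
    · rw [cubeEval_monomial, cubeEval_monomial]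
      congr 1
      refine Finset.prod_congr rfl fun j _ => ?_
      by_cases hji : j = i
      · rw [hji, hi, pow_zero, pow_zero]
      · rw [hx j (by simpa using hji)]
  rw [Finset.sum_eq_single y] at h0
  · have h1 : cubeIndicator Tᶜ y y = 1 := by simp [cubeIndicator]
    rw [h1, one_mul] at h0
    exact (mul_eq_zero.mp h0).resolve_right (signPow_ne_zero _ _)
  · intro x _ hxy
    by_cases hx : ∀ i ∈ T, x i = α i
    · have : ¬ ∀ i ∈ Tᶜ, x i = y i := fun hc => hxy <| _root_.funext fun i => by
        by_cases hi : i ∈ T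
        · rw [hx i hi, hy i hi]
        · exact hc i (Finset.mem_compl.mpr hi)
      rw [cubeIndicator, if_neg this, zero_mul, zero_mul]
    · rw [hq x hx, mul_zero, zero_mul]
  · simp

/-! ## Lower bounds from pseudo-expectations -/

/-- The properties of a linear functional that rule out refutations of degree or rank at most
`d`. -/
structure IsPseudoExp (P : Predicate k) (I : Instance n k m) (d : ℕ)
    (E : ((Fin n → Bool) → ℝ) →ₗ[ℝ] ℝ) : Prop where
  apply_one : E 1 = 1
  constraint_nonneg : ∀ (T : Finset (Fin n)) (α : Fin n → Bool), T.card ≤ d →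
    ∀ (l : Fin m) (f : (Fin n → Bool) → ℝ), DependsOn f (scopeVars I {l} : Set (Fin n)) →
      (∀ x, P (fun i => xor (x ((I l).2 i)) ((I l).1 i)) = true → 0 ≤ f x) →
      0 ≤ E (cubeIndicator T α * f)
  sq_affine_nonneg : ∀ (T : Finset (Fin n)) (α : Fin n → Bool), T.card ≤ d →
    ∀ (f : (Fin n → Bool) → ℝ) (a : ℝ) (c : Fin n → ℝ),
      (∀ x, f x = a + ∑ i, c i * boolSign (x i)) → 0 ≤ E (cubeIndicator T α * f ^ 2)

lemma isPseudoExp_pseudoExp {t s r d : ℕ} {P : Predicate k} {μ : (Fin k → Bool) → ℝ} {δ : ℝ}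
    {I : Instance n k m} (hμ : IsUniformDistribution t μ) (hμP : ∀ z, μ z ≠ 0 → P z = true)
    (hδ : 0 < δ) (hI : Expanding I (k - t / 2 + δ) s) (hrs : 2 * r ≤ s)
    (hd : (2 + k / δ) * (d + 1) + 1 ≤ δ * r) (hdk : d + k ≤ δ * (r - 1)) :
    IsPseudoExp P I d (pseudoExp μ I r) where
  apply_one := pseudoExp_one hμ hδ hI hrs
  constraint_nonneg T α hT l f hf hf0 := by
    refine pseudoExp_nonneg_of_constraint hμ hδ hI hrs (B := T ∪ scopeVars I {l}) ?_
      (DependsOn.mul_finset ((dependsOn_cubeIndicator T α).mono (by simp))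
        (hf.mono (by simp))) l fun x hx =>
        mul_nonneg (cubeIndicator_nonneg _ _ _) (hf0 x (hμP _ hx))
    refine le_trans ?_ hdk
    have h1 := card_scopeVars_le I {l}
    rw [Finset.card_singleton, mul_one] at h1
    exact_mod_cast (Finset.card_union_le _ _).trans (add_le_add hT h1)
  sq_affine_nonneg T α hT f a c hf := by
    have h1 : cubeIndicator T α * f ^ 2 =
        fun x => cubeIndicator T α x * (a + ∑ i, c i * boolSign (x i)) ^ 2 := by
      funext x
      rw [Pi.mul_apply, Pi.pow_apply, hf x]
    rw [h1]
    have hT' : (T.card : ℝ) ≤ d := by exact_mod_cast hT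
    refine pseudoExp_mul_sq_nonneg hμ hδ hI hrs (le_trans ?_ hd) (dependsOn_cubeIndicator T α)
      (cubeIndicator_nonneg T α) a c
    have : (0 : ℝ) ≤ k / δ := by positivity
    gcongr

section Refutations

variable {P : Predicate k} {I : Instance n k m} {d : ℕ} {E : ((Fin n → Bool) → ℝ) →ₗ[ℝ] ℝ}

lemma IsPseudoExp.indicator_nonneg (hE : IsPseudoExp P I d E) {T : Finset (Fin n)}
    (α : Fin n → Bool) (hT : T.card ≤ d) : 0 ≤ E (cubeIndicator T α) := by
  simpa using hE.sq_affine_nonneg T α hT 1 1 0 (by simp)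

lemma IsPseudoExp.affine_sq_nonneg (hE : IsPseudoExp P I d E) {η : RPoly n}
    (hη : η.totalDegree ≤ 1) {T : Finset (Fin n)} (α : Fin n → Bool) (hT : T.card ≤ d) :
    0 ≤ E (cubeIndicator T α * cubeEval (η ^ 2)) := by
  obtain ⟨a, c, hac⟩ := exists_affine_of_totalDegree_le_one hη
  rw [map_pow]
  exact hE.sq_affine_nonneg T α hT _ a c hac

lemma IsPseudoExp.degKFormulation_nonneg (hE : IsPseudoExp P I d E) {g : RPoly n}
    (hg : g ∈ degKFormulation P I) {T : Finset (Fin n)} (α : Fin n → Bool) (hT : T.card ≤ d) :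
    0 ≤ E (cubeIndicator T α * cubeEval g) := by
  obtain ⟨l, hl⟩ := hg
  have hdep : ∀ x y : Fin n → Bool, (∀ i ∈ (scopeVars I {l} : Set (Fin n)), x i = y i) →
      cubeEval (constraintPoly P (I l)) x = cubeEval (constraintPoly P (I l)) y := by
    intro x y h
    have : (fun i => xor (x ((I l).2 i)) ((I l).1 i)) =
        fun i => xor (y ((I l).2 i)) ((I l).1 i) := by
      funext i
      rw [h _ (Finset.mem_coe.mpr (mem_scopeVars.mpr ⟨l, by simp, i, rfl⟩))]
    rw [cubeEval_constraintPoly, cubeEval_constraintPoly, this]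
  refine hE.constraint_nonneg T α hT l _ (fun x y h => ?_) fun x hx => ?_
  · rcases hl with rfl | rfl <;>
      simp only [map_sub, Pi.sub_apply, hdep x y h, map_one, Pi.one_apply]
  · rcases hl with rfl | rfl <;>
      simp [map_sub, cubeEval_constraintPoly, hx]

lemma IsPseudoExp.linFormulation_nonneg (hE : IsPseudoExp P I d E) {g : RPoly n}
    (hg : g ∈ linFormulation P I) {T : Finset (Fin n)} (α : Fin n → Bool) (hT : T.card ≤ d) :
    0 ≤ E (cubeIndicator T α * cubeEval g) := by
  obtain ⟨l, f, hf, rfl⟩ := hg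
  have heval : ∀ x : Fin n → Bool, cubeEval (∑ i, signed (xor ((I l).1 i) (f i))
      (X ((I l).2 i)) - 1 : RPoly n) x =
      ∑ i, (if xor (x ((I l).2 i)) (xor ((I l).1 i) (f i)) then (1 : ℝ) else 0) - 1 := by
    intro x
    simp only [map_sub, map_sum, map_one, Pi.sub_apply, Finset.sum_apply, Pi.one_apply,
      cubeEval_signed]
  refine hE.constraint_nonneg T α hT l _ (fun x y h => ?_) fun x hx => ?_
  · rw [heval, heval]
    congr 1
    refine Finset.sum_congr rfl fun i _ => ?_
    rw [h _ (Finset.mem_coe.mpr (mem_scopeVars.mpr ⟨l, by simp, i, rfl⟩))]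
  · rw [heval, sub_nonneg]
    -- A satisfying assignment differs from the falsifying pattern `f` somewhere, and the literal at
    -- that place is true.
    obtain ⟨i, hi⟩ : ∃ i, xor (x ((I l).2 i)) ((I l).1 i) ≠ f i := by
      by_contra hno
      push Not at hno
      rw [_root_.funext hno, hf] at hx
      exact Bool.false_ne_true hx
    have h1 : (if xor (x ((I l).2 i)) (xor ((I l).1 i) (f i)) then (1 : ℝ) else 0) = 1 := by
      rw [← Bool.xor_assoc, if_pos]
      rw [Bool.xor_iff_ne]
      exact hi
    refine h1.symm.le.trans ?_
    exact Finset.single_le_sum (f := fun i => if xor (x ((I l).2 i)) (xor ((I l).1 i) (f i))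
      then (1 : ℝ) else 0) (fun j _ => by split_ifs <;> norm_num) (Finset.mem_univ i)

/-- A term of degree at most `d` of a static refutation has nonnegative pseudo-expectation. -/
lemma term_nonneg {γ : ℝ} (hγ : 0 ≤ γ) {g : RPoly n} {T : Finset (Fin n)} {α : Fin n → Bool}
    (hg : T.card ≤ d → 0 ≤ E (cubeIndicator T α * cubeEval g))
    (hd : mlDegree (C γ * g * indicatorPoly T α) ≤ d) :
    0 ≤ E (cubeEval (C γ * g * indicatorPoly T α)) := by
  by_cases hT : T.card ≤ d
  · have h1 : cubeEval (C γ * g * indicatorPoly T α) =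
        γ • (cubeIndicator T α * cubeEval g) := by
      funext x
      simp only [map_mul, Pi.mul_apply, cubeEval_C, cubeEval_indicatorPoly, Pi.smul_apply,
        smul_eq_mul]
      ring
    rw [h1, map_smul, smul_eq_mul]
    exact mul_nonneg hγ (hg hT)
  -- Cancellation could make the degree of the product smaller than `|T|`, but then the term is zero
  -- on the whole cube.
  · rw [cubeEval_eq_zero_of_mlDegree_lt (T := T) (α := α) (fun x hx => ?_) (by omega), map_zero]
    rw [map_mul, Pi.mul_apply, cubeEval_indicatorPoly, cubeIndicator, if_neg hx, mul_zero]

lemma cubeEval_sum_sq_sub (h : Fin n → RPoly n) :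
    cubeEval (∑ j, (X j ^ 2 - X j) * h j) = 0 := by
  funext x
  rw [map_sum, Finset.sum_apply]
  refine Finset.sum_eq_zero fun j _ => ?_
  simp only [map_mul, map_sub, map_pow, Pi.mul_apply, Pi.sub_apply, Pi.pow_apply, cubeEval_X]
  split_ifs <;> simp

lemma IsPseudoExp.map_cubeEval_neg_one (hE : IsPseudoExp P I d E) :
    E (cubeEval (-1 : RPoly n)) = -1 := by
  rw [map_neg, map_one, map_neg, hE.apply_one]

lemma IsPseudoExp.lt_degree_saPlus (hE : IsPseudoExp P I d E)
    (π : SAPlusRefutation (degKFormulation P I)) : d < π.degree := by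
  by_contra hdeg
  rw [not_lt, SAPlusRefutation.degree] at hdeg
  have h := congrArg (fun p => E (cubeEval p)) π.identity
  simp only [map_add, hE.map_cubeEval_neg_one, cubeEval_sum_sq_sub, add_zero] at h
  have h1 : 0 ≤ E (cubeEval (∑ i, C (π.γ i) * π.g i * indicatorPoly (π.T i) (π.α i))) := by
    rw [map_sum, map_sum]
    refine Finset.sum_nonneg fun i _ => term_nonneg (d := d) (π.γ_nonneg i) (fun hT => ?_) ?_
    · rcases π.g_mem i with hg | hg
      · exact hE.degKFormulation_nonneg hg _ hT
      · rw [hg, map_one, mul_one]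
        exact hE.indicator_nonneg _ hT
    · exact (Finset.le_sup (f := fun i => mlDegree (C (π.γ i) * π.g i *
        indicatorPoly (π.T i) (π.α i))) (Finset.mem_univ i)).trans
        (((le_max_left _ _).trans (le_max_left _ _)).trans hdeg)
  have h2 : 0 ≤ E (cubeEval (∑ l, π.η l ^ 2)) := by
    rw [map_sum, map_sum]
    refine Finset.sum_nonneg fun l _ => ?_
    have h3 := hE.affine_sq_nonneg (π.η_affine l) (T := ∅) (fun _ => true) (by simp)
    have h4 : cubeIndicator (∅ : Finset (Fin n)) (fun _ => true) = 1 :=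
      _root_.funext (cubeIndicator_empty _)
    rwa [h4, one_mul] at h3
  linarith

lemma IsPseudoExp.lt_degree_staticLSPlus (hE : IsPseudoExp P I d E)
    (π : StaticLSPlusRefutation (degKFormulation P I)) : d < π.degree := by
  by_contra hdeg
  rw [not_lt, StaticLSPlusRefutation.degree] at hdeg
  have h := congrArg (fun p => E (cubeEval p)) π.identity
  simp only [map_add, hE.map_cubeEval_neg_one, cubeEval_sum_sq_sub, add_zero] at h
  have h1 : 0 ≤ E (cubeEval (∑ i, C (π.γ i) * π.b i * indicatorPoly (π.T i) (π.α i))) := by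
    rw [map_sum, map_sum]
    refine Finset.sum_nonneg fun i _ => term_nonneg (d := d) (π.γ_nonneg i) (fun hT => ?_) ?_
    · rcases π.b_mem i with hg | ⟨η, hη, hg⟩
      · exact hE.degKFormulation_nonneg hg _ hT
      · rw [hg]
        exact hE.affine_sq_nonneg hη _ hT
    · exact (Finset.le_sup (f := fun i => mlDegree (C (π.γ i) * π.b i *
        indicatorPoly (π.T i) (π.α i))) (Finset.mem_univ i)).trans
        ((le_max_left _ _).trans hdeg)
  linarith

/-- Lifting by a literal `x_i = β` preserves nonnegativity of the pseudo-expectation, at the cost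
of one variable of conditioning. -/
lemma lift_nonneg {Q R : RPoly n} {e : ℕ} (hQ : ∀ (T : Finset (Fin n)) (α : Fin n → Bool),
      T.card ≤ e + 1 → 0 ≤ E (cubeIndicator T α * cubeEval Q)) (i : Fin n) (β : Bool)
    (hR : ∀ x, cubeEval R x = (if x i = β then 1 else 0) * cubeEval Q x)
    (T : Finset (Fin n)) (α : Fin n → Bool) (hT : T.card ≤ e) :
    0 ≤ E (cubeIndicator T α * cubeEval R) := by
  have h : cubeIndicator T α * cubeEval R = if i ∈ T then
      (if α i = β then cubeIndicator T α * cubeEval Q else 0)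
      else cubeIndicator (insert i T) (Function.update α i β) * cubeEval Q := by
    funext x
    rw [Pi.mul_apply, hR, ← mul_assoc, cubeIndicator_mul_eq]
    split_ifs <;> simp
  rw [h]
  split_ifs
  · exact hQ T α (by omega)
  · simp
  · exact hQ _ _ ((Finset.card_insert_le _ _).trans (by omega))

/-- Conditioning size plus accumulated rank stays within `d`. A lifted line conditioned on `T` is
either zero or its premise conditioned on `T` and at most one more variable. -/
lemma IsPseudoExp.lsPlus_line_nonneg (hE : IsPseudoExp P I d E) {l : List (RPoly n × ℕ)}
    (hl : IsLSPlusProof (linFormulation P I) l) : ∀ q ∈ l, ∀ (T : Finset (Fin n))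
    (α : Fin n → Bool), T.card + q.2 ≤ d → 0 ≤ E (cubeIndicator T α * cubeEval q.1) := by
  induction hl with
  | nil => simp
  | cons q l _ hstep ih =>
    intro q' hq'
    rcases List.mem_cons.mp hq' with rfl | hq'
    swap
    · exact ih q' hq'
    intro T α hT
    cases hstep with
    | hyp Q hQ => exact hE.linFormulation_nonneg hQ α (by simpa using hT)
    | square Q hQ =>
      obtain ⟨a, c, hac⟩ := exists_affine_of_mlDegree_le_one hQ
      rw [map_pow]
      exact hE.sq_affine_nonneg T α (by simpa using hT) _ a c hac
    | mulVar Q ρ i hQ _ =>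
      refine lift_nonneg (Q := Q) (e := d - (ρ + 1)) (fun T' α' hT' => ih _ hQ T' α' ?_) i true
        (fun x => ?_) T α ?_
      · simp only at hT ⊢; omega
      · rw [map_mul, Pi.mul_apply, cubeEval_X]
      · simp only at hT; omega
    | mulCompl Q ρ i hQ _ =>
      refine lift_nonneg (Q := Q) (e := d - (ρ + 1)) (fun T' α' hT' => ih _ hQ T' α' ?_) i false
        (fun x => ?_) T α ?_
      · simp only at hT ⊢; omega
      · rw [map_mul, Pi.mul_apply, map_sub, map_one, Pi.sub_apply, cubeEval_X]
        cases x i <;> simp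
      · simp only at hT; omega
    | combine Q R ρ σ a b hQ hR ha hb =>
      have h1 := ih _ hQ T α (by simp only at hT ⊢; omega)
      have h2 := ih _ hR T α (by simp only at hT ⊢; omega)
      have h3 : cubeIndicator T α * cubeEval (C a * Q + C b * R) =
          a • (cubeIndicator T α * cubeEval Q) + b • (cubeIndicator T α * cubeEval R) := by
        funext x
        simp only [map_add, map_mul, Pi.add_apply, Pi.mul_apply, cubeEval_C, Pi.smul_apply,
          smul_eq_mul]
        ring
      rw [h3, map_add, map_smul, map_smul, smul_eq_mul, smul_eq_mul]
      exact add_nonneg (mul_nonneg ha h1) (mul_nonneg hb h2)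
    | reduce Q R ρ hQ hQR =>
      have h1 := ih _ hQ T α hT
      rwa [← cubeEval_multilinearize, ← hQR, cubeEval_multilinearize] at h1

lemma IsPseudoExp.lt_rank_lsPlus (hE : IsPseudoExp P I d E)
    (π : LSPlusRefutation (linFormulation P I)) : d < π.rank := by
  by_contra hrank
  have h := hE.lsPlus_line_nonneg π.isProof _ π.root ∅ (fun _ => true)
    (by simpa using not_lt.mp hrank)
  have h4 : cubeIndicator (∅ : Finset (Fin n)) (fun _ => true) = 1 :=
    _root_.funext (cubeIndicator_empty _)
  rw [h4, one_mul, hE.map_cubeEval_neg_one] at h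
  linarith

end Refutations

end RandomCSP

end

noncomputable section

namespace RandomCSP

/-! ## Random instances are expanding -/

variable {n k m : ℕ}

lemma prob_setOf (p : Instance n k m → Prop) [DecidablePred p] :
    prob {I | p I} =
      ((Finset.univ.filter p).card : ℝ) / (Fintype.card (Instance n k m) : ℝ) := by
  rw [prob, ← Set.ncard_coe_finset]
  congr 3
  ext I
  simp

lemma prob_mono {E F : Set (Instance n k m)} (h : E ⊆ F) : prob E ≤ prob F := by
  unfold prob
  gcongr
  exact Set.toFinite F

lemma prob_biUnion_le {ι : Type*} (s : Finset ι) (E : ι → Set (Instance n k m)) :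
    prob {I | ∃ i ∈ s, I ∈ E i} ≤ ∑ i ∈ s, prob (E i) := by
  classical
  have h1 : ∀ i, prob (E i) = _ := fun i => prob_setOf (fun I => I ∈ E i)
  rw [prob_setOf, Finset.sum_congr rfl fun i _ => h1 i, ← Finset.sum_div]
  gcongr
  have h2 : (Finset.univ.filter fun I => ∃ i ∈ s, I ∈ E i) ⊆
      s.biUnion fun i => Finset.univ.filter fun I => I ∈ E i := by
    intro I hI
    simpa using hI
  exact_mod_cast (Finset.card_le_card h2).trans Finset.card_biUnion_le

lemma card_instance : Fintype.card (Instance n k m) = (2 ^ k * n ^ k) ^ m := by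
  simp [Instance, Constraint]

lemma prob_compl (hn : n ≠ 0) (E : Set (Instance n k m)) : prob Eᶜ = 1 - prob E := by
  have h0 : (Fintype.card (Instance n k m) : ℝ) ≠ 0 := by
    rw [card_instance]; positivity
  have h1 := Set.ncard_add_ncard_compl E
  rw [Nat.card_eq_fintype_card] at h1
  unfold prob
  rw [eq_sub_iff_add_eq, ← add_div, div_eq_one_iff_eq h0, ← h1]
  push_cast; ring

lemma prob_scopes_subset (hn : n ≠ 0) (H : Finset (Fin m)) (V : Finset (Fin n)) :
    prob {I : Instance n k m | scopeVars I H ⊆ V} = ((V.card : ℝ) / n) ^ (k * H.card) := by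
  classical
  have hset : (Finset.univ.filter fun I : Instance n k m => scopeVars I H ⊆ V) =
      Fintype.piFinset fun j => if j ∈ H then
        (Finset.univ : Finset (Fin k → Bool)) ×ˢ Fintype.piFinset fun _ : Fin k => V
        else Finset.univ := by
    ext I
    simp only [Finset.mem_filter, Finset.mem_univ, true_and, Fintype.mem_piFinset,
      Finset.subset_iff, mem_scopeVars]
    constructor
    · intro h j
      split_ifs with hj
      · simp only [Finset.mem_product, Finset.mem_univ, true_and, Fintype.mem_piFinset]
        exact fun i => h ⟨j, hj, i, rfl⟩
      · exact Finset.mem_univ _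
    · rintro h v ⟨j, hj, i, rfl⟩
      have := h j
      rw [if_pos hj] at this
      simp only [Finset.mem_product, Finset.mem_univ, true_and, Fintype.mem_piFinset] at this
      exact this i
  have hn' : (n : ℝ) ≠ 0 := by exact_mod_cast hn
  rw [prob_setOf, hset, Fintype.card_piFinset, card_instance]
  have hcard : ∀ j : Fin m, ((if j ∈ H then (Finset.univ : Finset (Fin k → Bool)) ×ˢ
      Fintype.piFinset fun _ : Fin k => V else Finset.univ).card : ℝ) =
      (2 ^ k * n ^ k) * if j ∈ H then ((V.card : ℝ) / n) ^ k else 1 := by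
    intro j
    split_ifs
    · rw [Finset.card_product, Fintype.card_piFinset_const, div_pow]
      simp only [Finset.card_univ, Fintype.card_pi, Fintype.card_bool, Finset.prod_const,
        Fintype.card_fin]
      push_cast
      field_simp
    · simp
  push_cast
  rw [Finset.prod_congr rfl fun j _ => hcard j, Finset.prod_mul_distrib, Finset.prod_const,
    Finset.card_univ, Fintype.card_fin, mul_comm, mul_div_assoc, div_self (by positivity), mul_one,
    Finset.prod_ite_mem, Finset.univ_inter, Finset.prod_const, ← pow_mul]

lemma prob_card_scopeVars_le (hn : n ≠ 0) (H : Finset (Fin m)) {v : ℕ} (hv : v ≤ n) :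
    prob {I : Instance n k m | (scopeVars I H).card ≤ v} ≤
      n.choose v * ((v : ℝ) / n) ^ (k * H.card) := by
  have h1 := prob_biUnion_le (Finset.powersetCard v (Finset.univ : Finset (Fin n)))
    fun V => {I : Instance n k m | scopeVars I H ⊆ V}
  refine (prob_mono ?_).trans (h1.trans ?_)
  · intro I hI
    obtain ⟨V, hV1, hV2⟩ := Finset.exists_superset_card_eq (s := scopeVars I H) (n := v) hI
      (by simpa using hv)
    exact ⟨V, by simpa using hV2, hV1⟩
  · rw [Finset.sum_congr rfl (g := fun _ => ((v : ℝ) / n) ^ (k * H.card))]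
    · simp
    · intro V hV
      rw [prob_scopes_subset hn, (Finset.mem_powersetCard.mp hV).2]

lemma pow_self_div_factorial_le_exp (v : ℕ) : (v : ℝ) ^ v / v.factorial ≤ Real.exp v :=
  Real.pow_div_factorial_le_exp _ (Nat.cast_nonneg v) v

/-- Of the `N` factors `v / n`, `v` of them absorb the choice of the variable set, at cost `v ^ v /
v! ≤ e ^ v`. -/
lemma choose_mul_div_pow_le (hn : n ≠ 0) {v N : ℕ} (hvN : v ≤ N) :
    (n.choose v : ℝ) * ((v : ℝ) / n) ^ N ≤ Real.exp v * ((v : ℝ) / n) ^ (N - v) := by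
  have hn' : (n : ℝ) ≠ 0 := by exact_mod_cast hn
  obtain ⟨w, rfl⟩ := Nat.exists_eq_add_of_le hvN
  rw [Nat.add_sub_cancel_left, pow_add, ← mul_assoc]
  gcongr
  calc (n.choose v : ℝ) * ((v : ℝ) / n) ^ v
      ≤ (n : ℝ) ^ v / v.factorial * ((v : ℝ) / n) ^ v := by
        gcongr
        exact Nat.choose_le_pow_div v n
    _ = (v : ℝ) ^ v / v.factorial := by
        rw [div_pow]
        field_simp
    _ ≤ Real.exp v := pow_self_div_factorial_le_exp v

lemma prob_card_scopeVars_lt_le (hn : n ≠ 0) {a : ℝ} (ha : 0 < a) (H : Finset (Fin m))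
    (hH : k * H.card ≤ n) :
    prob {I : Instance n k m | ((scopeVars I H).card : ℝ) < (k - a) * H.card} ≤
      Real.exp (k * H.card) * ((k * H.card : ℝ) / n) ^ (a * H.card) := by
  have hn' : (0 : ℝ) < n := by exact_mod_cast Nat.pos_of_ne_zero hn
  by_cases hempty : (k - a) * H.card ≤ 0
  · have : {I : Instance n k m | ((scopeVars I H).card : ℝ) < (k - a) * H.card} = ∅ := by
      ext I
      simp only [Set.mem_ofPred_eq, Set.mem_empty_iff_false, iff_false, not_lt]
      exact hempty.trans (Nat.cast_nonneg _)
    rw [this]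
    simp only [prob, Set.ncard_empty, Nat.cast_zero, zero_div]
    positivity
  push Not at hempty
  set N := k * H.card with hN
  set v := ⌊(k - a) * H.card⌋₊ with hv
  have hNcast : (N : ℝ) = k * H.card := by rw [hN]; push_cast; ring
  have hvle : (v : ℝ) ≤ (k - a) * H.card := Nat.floor_le hempty.le
  have haH : 0 ≤ a * (H.card : ℝ) := by positivity
  have hvN : v ≤ N := by
    have : (v : ℝ) ≤ N := by rw [hNcast]; linarith
    exact_mod_cast this
  have hNpos : (0 : ℝ) < N := by rw [hNcast]; linarith
  have hN1 : (N : ℝ) / n ≤ 1 := by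
    rw [div_le_one hn']
    exact_mod_cast hH
  calc prob {I : Instance n k m | ((scopeVars I H).card : ℝ) < (k - a) * H.card}
      ≤ prob {I : Instance n k m | (scopeVars I H).card ≤ v} :=
        prob_mono fun I hI => Nat.le_floor (le_of_lt hI)
    _ ≤ n.choose v * ((v : ℝ) / n) ^ N := prob_card_scopeVars_le hn H (hvN.trans hH)
    _ ≤ Real.exp v * ((v : ℝ) / n) ^ (N - v) := choose_mul_div_pow_le hn hvN
    _ ≤ Real.exp N * ((N : ℝ) / n) ^ (N - v) := by
        have : (v : ℝ) ≤ N := by exact_mod_cast hvN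
        gcongr
    _ ≤ Real.exp N * ((N : ℝ) / n) ^ (a * H.card) := by
        gcongr
        rw [← Real.rpow_natCast]
        refine Real.rpow_le_rpow_of_exponent_ge (by positivity) hN1 ?_
        rw [Nat.cast_sub hvN, hNcast]
        linarith
    _ = _ := by rw [hNcast]

/-- Since `m.choose h ≤ (e m / h) ^ h`, the sets of `h` constraints contribute at most `x ^ h`, and
the geometric series is at most `2 * x`. -/
lemma prob_not_expanding_le (hn : n ≠ 0) {a : ℝ} (ha : 0 < a) {s : ℕ} (hs : k * s ≤ n) {x : ℝ}
    (hx0 : 0 ≤ x) (hx : x ≤ 1 / 2)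
    (hbase : ∀ h : ℕ, 1 ≤ h → h ≤ s →
      Real.exp (k + 1) * ((m : ℝ) / h) * ((k * h : ℝ) / n) ^ a ≤ x) :
    prob {I : Instance n k m | ¬ Expanding I (k - a) s} ≤ 2 * x := by
  have hlevel : ∀ h : ℕ, 1 ≤ h → h ≤ s →
      ∑ H ∈ Finset.powersetCard h (Finset.univ : Finset (Fin m)),
        prob {I : Instance n k m | ((scopeVars I H).card : ℝ) < (k - a) * H.card} ≤ x ^ h := by
    intro h h1 hhs
    have hh : (0 : ℝ) < h := by exact_mod_cast h1
    have hterm : ∀ H ∈ Finset.powersetCard h (Finset.univ : Finset (Fin m)),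
        prob {I : Instance n k m | ((scopeVars I H).card : ℝ) < (k - a) * H.card} ≤
          (Real.exp k * ((k * h : ℝ) / n) ^ a) ^ h := by
      intro H hH
      have hHc := (Finset.mem_powersetCard.mp hH).2
      have := prob_card_scopeVars_lt_le hn ha H
        (by rw [hHc]; exact (Nat.mul_le_mul_left k hhs).trans hs)
      rw [hHc] at this ⊢
      refine this.trans_eq ?_
      rw [mul_pow, ← Real.exp_nat_mul, ← Real.rpow_mul_natCast (by positivity),
        mul_comm (h : ℝ) (k : ℝ)]
    refine (Finset.sum_le_card_nsmul _ _ _ hterm).trans ?_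
    rw [Finset.card_powersetCard, Finset.card_univ, Fintype.card_fin, nsmul_eq_mul]
    have hchoose : (m.choose h : ℝ) ≤ (Real.exp 1 * ((m : ℝ) / h)) ^ h := by
      have h2 := pow_self_div_factorial_le_exp h
      rw [div_le_iff₀ (by positivity)] at h2
      calc (m.choose h : ℝ) ≤ (m : ℝ) ^ h / h.factorial := Nat.choose_le_pow_div h m
        _ ≤ (Real.exp 1 * ((m : ℝ) / h)) ^ h := by
          rw [mul_pow, ← Real.exp_nat_mul, mul_one, div_pow, div_le_iff₀ (by positivity),
            mul_div_assoc', div_mul_eq_mul_div, le_div_iff₀ (by positivity)]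
          nlinarith [pow_nonneg (Nat.cast_nonneg (α := ℝ) m) h]
    calc (m.choose h : ℝ) * (Real.exp k * ((k * h : ℝ) / n) ^ a) ^ h
        ≤ (Real.exp 1 * ((m : ℝ) / h)) ^ h * (Real.exp k * ((k * h : ℝ) / n) ^ a) ^ h := by
          gcongr
      _ = (Real.exp (k + 1) * ((m : ℝ) / h) * ((k * h : ℝ) / n) ^ a) ^ h := by
          rw [← mul_pow, Real.exp_add]
          ring
      _ ≤ x ^ h := by
          gcongr
          exact hbase h h1 hhs
  -- Sizes are indexed by `h + 1`, since the empty set never violates expansion.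
  have hsub : {I : Instance n k m | ¬ Expanding I (k - a) s} ⊆
      {I | ∃ h ∈ Finset.range s, I ∈ {I : Instance n k m |
        ∃ H ∈ Finset.powersetCard (h + 1) (Finset.univ : Finset (Fin m)),
          I ∈ {I : Instance n k m | ((scopeVars I H).card : ℝ) < (k - a) * H.card}}} := by
    intro I hI
    simp only [Set.mem_ofPred_eq, Expanding, not_forall, not_le] at hI
    obtain ⟨H, hHs, hH⟩ := hI
    have hpos : H.card ≠ 0 := by
      intro h0
      rw [h0, Nat.cast_zero, mul_zero] at hH
      exact absurd hH (not_lt.mpr (Nat.cast_nonneg _))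
    obtain ⟨h, hh⟩ := Nat.exists_eq_succ_of_ne_zero hpos
    exact ⟨h, by simp only [Finset.mem_range]; omega, H, by simp [hh], hH⟩
  calc prob {I : Instance n k m | ¬ Expanding I (k - a) s}
      ≤ ∑ h ∈ Finset.range s, x ^ (h + 1) := by
        refine (prob_mono hsub).trans ((prob_biUnion_le _ _).trans
          (Finset.sum_le_sum fun h hh => (prob_biUnion_le _ _).trans (hlevel (h + 1) (by omega) ?_)))
        rw [Finset.mem_range] at hh
        omega
    _ = x * ∑ h ∈ Finset.range s, x ^ h := by
        rw [Finset.mul_sum]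
        exact Finset.sum_congr rfl fun h _ => pow_succ' x h
    _ ≤ x * (1 - x)⁻¹ := by
        gcongr
        exact sum_le_hasSum _ (fun i _ => pow_nonneg hx0 i)
          (hasSum_geometric_of_lt_one hx0 (by linarith))
    _ ≤ x * 2 := by
        gcongr
        rw [inv_le_comm₀ (by linarith) (by norm_num)]
        linarith
    _ = 2 * x := mul_comm _ _

end RandomCSP

end

/-! ### Asymptotics in `n` and the choice of parameters -/

noncomputable section

namespace RandomCSP

open Filter Topology

lemma union_bound_base_le {n M h : ℕ} {k : ℕ} {t ε δ θ K a : ℝ} (hn : n ≠ 0) (hh : 1 ≤ h)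
    (hK : 0 ≤ K) (hhK : (h : ℝ) ≤ K * (n : ℝ) ^ θ) (hM : (M : ℝ) ≤ (n : ℝ) ^ (t / 2 - ε))
    (ha : a = t / 2 - δ) (ha1 : 1 ≤ a) (hδ : 0 ≤ δ) (hδε : δ ≤ ε / 4) (hθ : 0 ≤ θ)
    (hθε : θ * (t - 2) ≤ ε) :
    Real.exp (k + 1) * ((M : ℝ) / h) * ((k * h : ℝ) / n) ^ a ≤
      Real.exp (k + 1) * (k : ℝ) ^ a * K ^ (a - 1) * (n : ℝ) ^ (-(ε / 4)) := by
  have hn' : (0 : ℝ) < n := by exact_mod_cast Nat.pos_of_ne_zero hn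
  have hn1 : (1 : ℝ) ≤ n := by exact_mod_cast Nat.one_le_iff_ne_zero.mpr hn
  have hh' : (0 : ℝ) < h := by exact_mod_cast hh
  have h1 : ((k * h : ℝ) / n) ^ a = (k : ℝ) ^ a * ((h : ℝ) ^ (a - 1) * h) * (n : ℝ) ^ (-a) := by
    rw [Real.div_rpow (by positivity) hn'.le, Real.mul_rpow (by positivity) hh'.le,
      Real.rpow_neg hn'.le, ← Real.rpow_add_one hh'.ne', sub_add_cancel, div_eq_mul_inv]
  calc Real.exp (k + 1) * ((M : ℝ) / h) * ((k * h : ℝ) / n) ^ a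
      = Real.exp (k + 1) * (k : ℝ) ^ a * (M * (h : ℝ) ^ (a - 1) * (n : ℝ) ^ (-a)) := by
        rw [h1]
        field_simp
    _ ≤ Real.exp (k + 1) * (k : ℝ) ^ a *
        ((n : ℝ) ^ (t / 2 - ε) * (K * (n : ℝ) ^ θ) ^ (a - 1) * (n : ℝ) ^ (-a)) := by
        have : 0 ≤ a - 1 := by linarith
        gcongr
    _ = Real.exp (k + 1) * (k : ℝ) ^ a * K ^ (a - 1) *
        (n : ℝ) ^ (t / 2 - ε + θ * (a - 1) + -a) := by
        rw [Real.mul_rpow hK (by positivity), ← Real.rpow_mul hn'.le, Real.rpow_add hn',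
          Real.rpow_add hn']
        ring
    -- The exponent is `-ε + δ + θ (t/2 - 1 - δ)`, at most `-ε + ε/4 + ε/2`.
    _ ≤ _ := by
        gcongr
        nlinarith

/-- Random instances with at most `n ^ (t / 2 - ε)` constraints expand up to scale `n ^ θ`. -/
lemma tendsto_prob_not_expanding (k : ℕ) {t ε δ θ K : ℝ} (hδ : 0 ≤ δ)
    (hε : 0 < ε) (hδε : δ ≤ ε / 4) (hδt : δ ≤ t / 2 - 1) (hθ : 0 ≤ θ) (hθ1 : θ < 1)
    (hθε : θ * (t - 2) ≤ ε) (hK : 0 ≤ K) {m s : ℕ → ℕ}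
    (hm : ∀ n : ℕ, (m n : ℝ) ≤ (n : ℝ) ^ (t / 2 - ε))
    (hs : ∀ n : ℕ, n ≠ 0 → (s n : ℝ) ≤ K * (n : ℝ) ^ θ) :
    Tendsto (fun n : ℕ => prob {I : Instance n k (m n) | ¬ Expanding I (k - t / 2 + δ) (s n)})
      atTop (𝓝 0) := by
  set a := t / 2 - δ with ha
  set D := Real.exp (k + 1) * (k : ℝ) ^ a * K ^ (a - 1) with hD
  have hD0 : 0 ≤ D := by positivity
  have hx : Tendsto (fun n : ℕ => D * (n : ℝ) ^ (-(ε / 4))) atTop (𝓝 0) := by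
    have := ((tendsto_rpow_neg_atTop (by linarith : 0 < ε / 4)).comp
      tendsto_natCast_atTop_atTop).const_mul D
    simpa using this
  have hlarge : ∀ᶠ n : ℕ in atTop, k * K ≤ (n : ℝ) ^ (1 - θ) :=
    ((tendsto_rpow_atTop (by linarith : 0 < 1 - θ)).comp
      tendsto_natCast_atTop_atTop).eventually_ge_atTop _
  have h2x : Tendsto (fun n : ℕ => 2 * (D * (n : ℝ) ^ (-(ε / 4)))) atTop (𝓝 0) := by
    simpa using hx.const_mul 2
  refine squeeze_zero' (Eventually.of_forall fun n => by unfold prob; positivity) ?_ h2x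
  filter_upwards [hlarge, hx.eventually_le_const (by norm_num : (0 : ℝ) < 1 / 2),
    eventually_ne_atTop 0] with n hn1 hn2 hn0
  have hn' : (0 : ℝ) < n := by exact_mod_cast Nat.pos_of_ne_zero hn0
  have hκ : (k : ℝ) - t / 2 + δ = k - a := by rw [ha]; ring
  rw [hκ]
  refine prob_not_expanding_le hn0 (by linarith) ?_ (by positivity) hn2 fun h h1 hhs => ?_
  · have h3 : (k * s n : ℝ) ≤ n := by
      calc (k * s n : ℝ) ≤ k * (K * (n : ℝ) ^ θ) := by gcongr; exact hs n hn0
        _ = k * K * (n : ℝ) ^ θ := by ring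
        _ ≤ (n : ℝ) ^ (1 - θ) * (n : ℝ) ^ θ := by gcongr
        _ = n := by rw [← Real.rpow_add hn', sub_add_cancel, Real.rpow_one]
    exact_mod_cast h3
  · refine union_bound_base_le hn0 h1 hK (le_trans ?_ (hs n hn0)) (hm n) ha (by linarith) hδ hδε
      hθ hθε
    exact_mod_cast hhs

lemma Expanding.of_le {n k m : ℕ} {I : Instance n k m} {κ : ℝ} {s : ℕ} (h : Expanding I κ s)
    (hms : m ≤ s) (s' : ℕ) : Expanding I κ s' := fun H _ =>
  h H ((Finset.card_le_univ H).trans (by simpa using hms))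

lemma exists_isUniformDistribution {k t : ℕ} {P : Predicate k} (ht : 1 ≤ t)
    (hP : UniformSupporting (t - 1) P) :
    ∃ μ, IsUniformDistribution t μ ∧ ∀ z, μ z ≠ 0 → P z = true := by
  obtain ⟨μ, h0, h1, h2, h3⟩ := hP
  exact ⟨μ, ⟨h0, h1, fun V hV hVt =>
    fourierCoef_eq_zero h3 (Finset.nonempty_iff_ne_empty.mpr hV) (by omega)⟩, h2⟩

/-- Random instances expand to the scale at which refutations of degree `n ^ (ε / (t - 2))` are
excluded. -/
lemma tendsto_prob_not_expanding_ceil (k : ℕ) {t ε δ : ℝ} (ht : 3 ≤ t) (hδ : 0 ≤ δ)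
    (hε : 0 < ε) (hδε : δ ≤ ε / 4) (hδt : δ ≤ t / 2 - 1) (R : ℕ) {m : ℕ → ℕ}
    (hm : ∀ n : ℕ, (m n : ℝ) ≤ (n : ℝ) ^ (t / 2 - ε)) :
    Tendsto (fun n : ℕ => prob {I : Instance n k (m n) |
      ¬ Expanding I (k - t / 2 + δ) (2 * (R * (⌈(n : ℝ) ^ (ε / (t - 2))⌉₊ + 1)))})
      atTop (𝓝 0) := by
  have ht2 : 0 < t - 2 := by linarith
  by_cases hεt : ε < t - 2
  -- With `y = n ^ θ ≥ 1`, the scale is at most `2 R (y + 2) ≤ 6 R y`. Here `θ < 1`, so `k * s ≤ n`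
  -- eventually.
  · refine tendsto_prob_not_expanding k (θ := ε / (t - 2)) (K := 6 * R) hδ hε hδε hδt
      (by positivity) ((div_lt_one ht2).mpr hεt) (div_mul_cancel₀ _ ht2.ne').le (by positivity) hm
      fun n hn => ?_
    have hn1 : (1 : ℝ) ≤ n := by exact_mod_cast Nat.one_le_iff_ne_zero.mpr hn
    have h1 : 1 ≤ (n : ℝ) ^ (ε / (t - 2)) := Real.one_le_rpow hn1 (by positivity)
    have h2 := (Nat.ceil_lt_add_one (by positivity : 0 ≤ (n : ℝ) ^ (ε / (t - 2)))).le
    push_cast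
    have hR : (0 : ℝ) ≤ R := Nat.cast_nonneg R
    nlinarith
  · push Not at hεt
    -- When `ε ≥ t - 2`, the bound gives `m ≤ n ^ (1/2)` because `t/2 - ε ≤ 2 - t/2 ≤ 1/2`.
    -- Expansion to scale `√n` then covers all sets of constraints.
    have h := tendsto_prob_not_expanding k (θ := 1 / 2) (K := 1) (s := fun n =>
      ⌊(n : ℝ) ^ (1 / 2 : ℝ)⌋₊) hδ hε hδε hδt (by norm_num) (by norm_num) (by linarith)
      zero_le_one hm (fun n _ => by
        rw [one_mul]
        exact Nat.floor_le (by positivity))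
    refine squeeze_zero' (Eventually.of_forall fun n => by unfold prob; positivity) ?_ h
    filter_upwards [eventually_ne_atTop 0] with n hn
    have hn1 : (1 : ℝ) ≤ n := by exact_mod_cast Nat.one_le_iff_ne_zero.mpr hn
    refine prob_mono fun I hI hI' => hI (hI'.of_le (Nat.le_floor ((hm n).trans ?_)) _)
    exact Real.rpow_le_rpow_of_exponent_le hn1 (by linarith)

end RandomCSP

end

theorem theorem4 {k : ℕ} (P : RandomCSP.Predicate k) (t : ℕ) (ht : 3 ≤ t)
    (hP : RandomCSP.UniformSupporting (t - 1) P) (ε : ℝ) (hε : 0 < ε) :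
    ∃ c : ℝ, 0 < c ∧ ∀ m : ℕ → ℕ, (∀ n : ℕ, (m n : ℝ) ≤ (n : ℝ) ^ ((t : ℝ) / 2 - ε)) →
      Filter.Tendsto
        (fun n : ℕ => RandomCSP.prob {I : RandomCSP.Instance n k (m n) |
          (∀ π : RandomCSP.SAPlusRefutation (RandomCSP.degKFormulation P I),
            c * (n : ℝ) ^ (ε / ((t : ℝ) - 2)) ≤ (π.degree : ℝ)) ∧
          (∀ π : RandomCSP.StaticLSPlusRefutation (RandomCSP.degKFormulation P I),
            c * (n : ℝ) ^ (ε / ((t : ℝ) - 2)) ≤ (π.degree : ℝ)) ∧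
          (∀ π : RandomCSP.LSPlusRefutation (RandomCSP.linFormulation P I),
            c * (n : ℝ) ^ (ε / ((t : ℝ) - 2)) ≤ (π.rank : ℝ))})
        Filter.atTop (nhds 1) := by
  -- The constant 1 suffices: all dependence on the parameters goes into the truncation level `r = R
  -- (d + 1)`.
  refine ⟨1, one_pos, fun m hm => ?_⟩
  obtain ⟨μ, hμ, hμP⟩ := RandomCSP.exists_isUniformDistribution (by omega) hP
  have ht' : (3 : ℝ) ≤ t := by exact_mod_cast ht
  -- The bound `ε / 4` leaves a negative exponent in the union bound, and `1 / 2 ≤ t / 2 - 1` keeps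
  -- `t / 2 - δ ≥ 1`.
  set δ : ℝ := min (ε / 4) (1 / 2) with hδdef
  have hδ : 0 < δ := lt_min (by linarith) (by norm_num)
  have hδε : δ ≤ ε / 4 := min_le_left _ _
  have hδ2 : δ ≤ 1 / 2 := min_le_right _ _
  -- With `r = R (d + 1)`, this makes `δ r` at least `(4 + k / δ + k) (d + 1)`, enough for both size
  -- conditions of `isPseudoExp_pseudoExp`.
  obtain ⟨R, hR⟩ := exists_nat_ge ((4 + k / δ + k) / δ)
  rw [div_le_iff₀ hδ, mul_comm] at hR
  have hlim := RandomCSP.tendsto_prob_not_expanding_ceil k ht' hδ.le hε hδε (by linarith) R hm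
  have hlim1 := hlim.const_sub 1
  rw [sub_zero] at hlim1
  refine tendsto_of_tendsto_of_tendsto_of_le_of_le' hlim1 tendsto_const_nhds ?_ ?_
  · filter_upwards [Filter.eventually_ne_atTop 0] with n hn
    rw [← RandomCSP.prob_compl hn]
    refine RandomCSP.prob_mono fun I hI => ?_
    have hI' : RandomCSP.Expanding I (k - t / 2 + δ)
        (2 * (R * (⌈(n : ℝ) ^ (ε / ((t : ℝ) - 2))⌉₊ + 1))) := not_not.mp hI
    set d := ⌈(n : ℝ) ^ (ε / ((t : ℝ) - 2))⌉₊ with hd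
    have hd0 : (0 : ℝ) ≤ d := Nat.cast_nonneg d
    have hk0 : (0 : ℝ) ≤ k := Nat.cast_nonneg k
    have hkδ : (0 : ℝ) ≤ k / δ := by positivity
    have hRd : (4 + k / δ + k) * (d + 1) ≤ δ * ((R * (d + 1) : ℕ) : ℝ) := by
      push_cast
      rw [← mul_assoc]
      gcongr
    have hE := RandomCSP.isPseudoExp_pseudoExp hμ hμP hδ hI' le_rfl (d := d)
      (by nlinarith) (by nlinarith)
    have hle : ∀ x : ℕ, d < x → 1 * (n : ℝ) ^ (ε / ((t : ℝ) - 2)) ≤ x := by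
      intro x hx
      rw [one_mul]
      exact (Nat.le_ceil _).trans (Nat.cast_le.mpr hx.le)
    exact ⟨fun π => hle _ (hE.lt_degree_saPlus π), fun π => hle _ (hE.lt_degree_staticLSPlus π),
      fun π => hle _ (hE.lt_rank_lsPlus π)⟩
  · filter_upwards [Filter.eventually_ne_atTop 0] with n hn
    have h1 := RandomCSP.prob_compl hn (m := m n) (k := k)
    refine sub_nonneg.mp ?_
    rw [← h1]
    unfold RandomCSP.prob
    positivity
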